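/- Let $d\ge 1$ and $m\ge 2$ be integers, $\mathbb R_+=[0,\infty)$, and let $a\in C^m(\mathbb R_+)$ satisfy $a_0\le a(t)\le a_1$ for some constants $0<a_0\le a_1$. Let $\Theta,\Xi$ be positive and monotone increasing on $\mathbb R_+$, and let $\Lambda$ be positive, continuous and strictly increasing on $\mathbb R_+$ with $\Lambda(t)\to\infty$ as $t\to\infty$. $\Lambda^{-1}$ denotes the inverse of $\Lambda$ on $[\Lambda(0),\infty)$, extended by $\Lambda^{-1}(s)=0$ for $s<\Lambda(0)$. Assume: * there is $a_\infty>0$ with $\int_0^t|a(s)-a_\infty|\,ds\le\Theta(t)$ for all $t\ge0$; * there are constants $C_k$ with $|a^{(k)}(t)|\le C_k\,\Xi(t)^{-k}$ for $k=1,\dots,m$ and $t\ge 0$; * $\Theta/\Lambda$ is monotone increasing and $\Theta(t)/\Lambda(t)\to\infty$ as $t\to\infty$; * there is $C_0>0$ with $\Lambda(t)\le C_0\,\Xi(t)$ for all $t\ge 0$; * $\Xi^{-m}\in L^1(\mathbb R_+)$ and $\sup_{t\ge0}\Lambda(t)^m\,\Theta(t)^{-1}\int_t^\infty\Xi(s)^{-m}\,ds<\infty$.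 For $f:\mathbb Z^d\to\mathbb C$ put $D_j^+f[k]=f[k+e_j]-f[k]$, $D_j^-f[k]=f[k]-f[k-e_j]$ and $\hat f(\theta)=\sum_{k}e^{-ik\cdot\theta}f[k]$. For $u_0,u_1\in \ell^2(\mathbb Z^d)$ let $u\in C^2(\mathbb R_+;\ell^2(\mathbb Z^d))$ be the solution of $$u''(t)[k]-a(t)^2\sum_{j=1}^dD_j^+D_j^-u(t)[k]=0,\qquad u(0)=u_0,\quad u'(0)=u_1,$$ with energy $E(t)=\sum_k|u'(t)[k]|^2+a(t)^2\sum_{j=1}^d\sum_k|D_j^+u(t)[k]|^2$. Let $\xi(\theta)=(2\sin\frac{\theta_1}2,\dots,2\sin\frac{\theta_d}2)$, $\mathcal E(0,\theta)=|\hat u_1(\theta)|^2+a(0)^2|\xi(\theta)|^2|\hat u_0(\theta)|^2$ and, for $N>0$, $$U(N,u_0,u_1)=\int_{[-\pi,\pi]^d}\exp\Big(2|\xi(\theta)|\,\Theta\big(\Lambda^{-1}(N/|\xi(\theta)|)\big)\Big)\,\mathcal E(0,\theta)\,d\theta .$$ Let $\{M_j\}_{j\ge 0}$ be a sequence of positive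 reals which is logarithmically convex, i.e. $M_j/M_{j-1}\le M_{j+1}/M_j$ for $j\ge 1$; for a positive sequence put $T[\{M_j\}](\tau)=\sup_{j\ge1}\tau^j/M_j\in[0,\infty]$ ($\tau\ge0$). Assume that $$L(N,\{M_j\}):=\inf_{\tau\ge1}\frac{T[\{M_j/j!\}](\tau)}{\exp\big(\tau^{-1}\Theta(\Lambda^{-1}(N\tau))\big)}>0$$ for some $N>0$. For $u_0,u_1\in\ell^2(\mathbb Z^d)$ and $\rho>0$ consider the conditions $$\text{(M)}\quad \sum_{k\in\mathbb Z^d}k^\alpha D_j^+u_0[k]=0\ (j=1,\dots,d),\quad \sum_{k\in\mathbb Z^d}k^\alpha u_1[k]=0\quad\text{for all multi-indices }\alpha\in\mathbb Z_{\ge0}^d,$$ $$\text{(D}_\rho)\quad \sup_{k\in\mathbb Z^d}\Big(\sum_{j=1}^d|D_j^+u_0[k]|+|u_1[k]|\Big)|k|^{d+1}\,T[\{M_j\}](|k|/\rho)<\infty,$$ where $|k|$ is the Euclidean norm and $0\cdot\infty=0$. (i) If $L(N,\{M_j\})>0$ for every $N>0$, then for every $\rho>0$ there are constants $N_0>0$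 and $C\ge0$ such that for all $u_0,u_1\in\ell^2(\mathbb Z^d)$ satisfying (M) and (D$_\rho$): $U(N_0,u_0,u_1)<\infty$ and $E(t)\le C\,U(N_0,u_0,u_1)$ for all $t\ge0$. (ii) If $$\lim_{N\to\infty}\ \inf_{\tau\ge 1/(2\sqrt d)}\ \frac{\Theta(\Lambda^{-1}(N\tau))}{N\,\Theta(\Lambda^{-1}(\tau))}=\infty,$$ then there are constants $\rho>0$, $N_0>0$ and $C\ge0$ such that for all $u_0,u_1\in\ell^2(\mathbb Z^d)$ satisfying (M) and (D$_\rho$): $U(N_0,u_0,u_1)<\infty$ and $E(t)\le C\,U(N_0,u_0,u_1)$ for all $t\ge0$. -/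

import Mathlib

open Set Filter Topology MeasureTheory
open scoped ENNReal NNReal Nat

namespace SemiDiscreteWave

noncomputable section

/-- The lattice `ℤ^d`. -/
abbrev Lattice (d : ℕ) : Type := Fin d → ℤ

/-- The Hilbert space `l²(ℤ^d)` of complex valued sequences. -/
abbrev SqSummable (d : ℕ) : Type := lp (fun _ : Lattice d => ℂ) 2

/-- The Euclidean length `|k|` of a lattice point. -/
def latticeNorm {d : ℕ} (k : Lattice d) : ℝ := Real.sqrt (∑ i, (k i : ℝ) ^ 2)

/-- Forward difference `D_j^+ f [k] = f[k + e_j] - f[k]`. -/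
def fwdDiff {d : ℕ} (j : Fin d) (f : Lattice d → ℂ) (k : Lattice d) : ℂ :=
  f (k + Pi.single j 1) - f k

/-- Backward difference `D_j^- f [k] = f[k] - f[k - e_j]`. -/
def bwdDiff {d : ℕ} (j : Fin d) (f : Lattice d → ℂ) (k : Lattice d) : ℂ :=
  f k - f (k - Pi.single j 1)

/-- The discrete Laplace operator `∑_j D_j^+ D_j^-`. -/
def discreteLaplacian {d : ℕ} (f : Lattice d → ℂ) (k : Lattice d) : ℂ :=
  ∑ j, fwdDiff j (bwdDiff j f) k

/-- `u` is an `l²(ℤ^d)`-valued solution on `[0, ∞)`, with time derivative `v = u'`, of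
`u''(t)[k] = a(t)² ∑_j D_j^+ D_j^- u(t)[k]`, `u(0) = u₀`, `u'(0) = u₁`.
Time derivatives are one-sided at `t = 0`. -/
structure IsSolution {d : ℕ} (a : ℝ → ℝ) (u₀ u₁ : SqSummable d)
    (u v : ℝ → SqSummable d) : Prop where
  init_pos : u 0 = u₀
  init_vel : v 0 = u₁
  deriv_pos : ∀ t, 0 ≤ t → HasDerivWithinAt u (v t) (Ici 0) t
  deriv_vel : ∀ t, 0 ≤ t → ∃ w : SqSummable d, HasDerivWithinAt v w (Ici 0) t ∧
    ∀ k, w k = (a t : ℂ) ^ 2 * discreteLaplacian (u t) k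

/-- The total energy `∑_k |v[k]|² + c² ∑_j ∑_k |D_j^+ u[k]|²`, as an element of `[0, ∞]`. -/
def energy {d : ℕ} (c : ℝ) (u v : Lattice d → ℂ) : ℝ≥0∞ :=
  (∑' k, ‖v k‖ₑ ^ 2) + ENNReal.ofReal (c ^ 2) * ∑ j, ∑' k, ‖fwdDiff j u k‖ₑ ^ 2

/-- The discrete-time Fourier transform `∑_k e^{-i k·θ} f[k]`. It is used below only for
absolutely summable `f`: a sequence in `l²` whose forward differences in all directions decay
faster than every power of `|k|` is itself absolutely summable. -/
def dtft {d : ℕ} (f : Lattice d → ℂ) (θ : Fin d → ℝ) : ℂ :=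
  ∑' k, Complex.exp (-Complex.I * ∑ i, ((k i : ℂ) * (θ i : ℂ))) * f k

/-- `|ξ(θ)|` for `ξ(θ) = (2 sin (θ_1 / 2), …, 2 sin (θ_d / 2))`. -/
def xiNorm {d : ℕ} (θ : Fin d → ℝ) : ℝ := Real.sqrt (∑ i, (2 * Real.sin (θ i / 2)) ^ 2)

/-- The initial energy density `|û₁(θ)|² + c² |ξ(θ)|² |û₀(θ)|²`, where `c = a(0)`. -/
def energyDensity {d : ℕ} (c : ℝ) (u₀ u₁ : Lattice d → ℂ) (θ : Fin d → ℝ) : ℝ :=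
  ‖dtft u₁ θ‖ ^ 2 + c ^ 2 * xiNorm θ ^ 2 * ‖dtft u₀ θ‖ ^ 2

/-- The inverse of a strictly increasing continuous function `Λ` on `[0, ∞)` with limit `∞`:
the inverse function on `[Λ 0, ∞)`, extended by `0` below `Λ 0`. -/
def halfLineInv (Λ : ℝ → ℝ) (s : ℝ) : ℝ := sSup {t | 0 ≤ t ∧ Λ t ≤ s}

theorem halfLineInv_apply {Λ : ℝ → ℝ} (h : StrictMonoOn Λ (Ici 0)) {t : ℝ} (ht : 0 ≤ t) :
    halfLineInv Λ (Λ t) = t := by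
  have : {r | 0 ≤ r ∧ Λ r ≤ Λ t} = Icc 0 t := by
    ext r
    constructor
    · rintro ⟨h0, h1⟩
      exact ⟨h0, (h.le_iff_le h0 ht).1 h1⟩
    · rintro ⟨h0, h1⟩
      exact ⟨h0, (h.le_iff_le h0 ht).2 h1⟩
  rw [halfLineInv, this, csSup_Icc ht]

theorem halfLineInv_of_lt {Λ : ℝ → ℝ} (h : StrictMonoOn Λ (Ici 0)) {s : ℝ} (hs : s < Λ 0) :
    halfLineInv Λ s = 0 := by
  have : {r | 0 ≤ r ∧ Λ r ≤ s} = ∅ := by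
    refine eq_empty_of_forall_notMem ?_
    rintro r ⟨h0, h1⟩
    exact absurd (hs.trans_le (h.monotoneOn (mem_Ici.2 le_rfl) h0 h0)) (not_lt.2 h1)
  rw [halfLineInv, this, Real.sSup_empty]

/-- The weighted initial energy
`U(N, u₀, u₁) = ∫_{[-π, π]^d} exp (2 |ξ(θ)| Θ(Λ⁻¹(N / |ξ(θ)|))) 𝓔(0, θ) dθ`. -/
def weightedEnergy {d : ℕ} (a Θ Λ : ℝ → ℝ) (N : ℝ) (u₀ u₁ : Lattice d → ℂ) : ℝ≥0∞ :=
  ∫⁻ θ in Icc (fun _ : Fin d => -Real.pi) (fun _ => Real.pi),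
    ENNReal.ofReal (Real.exp (2 * xiNorm θ * Θ (halfLineInv Λ (N / xiNorm θ)))
      * energyDensity (a 0) u₀ u₁ θ)

/-- Logarithmic convexity: `M_j / M_{j-1} ≤ M_{j+1} / M_j` for `j ≥ 1`. -/
def LogConvexSeq (M : ℕ → ℝ) : Prop :=
  ∀ j : ℕ, 1 ≤ j → M j / M (j - 1) ≤ M (j + 1) / M j

/-- The associated function `T[{M_j}](τ) = sup_{j ≥ 1} τ^j / M_j`, with values in `[0, ∞]`. -/
def assocFun (M : ℕ → ℝ) (τ : ℝ) : ℝ≥0∞ :=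
  ⨆ (j : ℕ) (_ : 1 ≤ j), ENNReal.ofReal (τ ^ j / M j)

/-- `L(N, {M_j}) = inf_{τ ≥ 1} T[{M_j / j!}](τ) / exp (τ⁻¹ Θ(Λ⁻¹(N τ)))`. -/
def dominationConst (Θ Λ : ℝ → ℝ) (M : ℕ → ℝ) (N : ℝ) : ℝ≥0∞ :=
  ⨅ (τ : ℝ) (_ : 1 ≤ τ), assocFun (fun j => M j / (j ! : ℝ)) τ /
    ENNReal.ofReal (Real.exp (τ⁻¹ * Θ (halfLineInv Λ (N * τ))))

/-- `∑_k k^α f[k] = 0` for every multi-index `α`. -/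
def VanishingMoments {d : ℕ} (f : Lattice d → ℂ) : Prop :=
  ∀ α : Fin d → ℕ, HasSum (fun k : Lattice d => (∏ i, (k i : ℂ) ^ α i) * f k) 0

/-- The data have vanishing moments of all orders. -/
def DataMoments {d : ℕ} (u₀ u₁ : Lattice d → ℂ) : Prop :=
  (∀ j, VanishingMoments (fwdDiff j u₀)) ∧ VanishingMoments u₁

/-- `sup_k (∑_j |D_j^+ u₀[k]| + |u₁[k]|) |k|^{d+1} T[{M_j}](|k| / ρ) < ∞`. -/
def DataDecay {d : ℕ} (M : ℕ → ℝ) (ρ : ℝ) (u₀ u₁ : Lattice d → ℂ) : Prop :=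
  (⨆ k : Lattice d,
    ENNReal.ofReal (((∑ j, ‖fwdDiff j u₀ k‖) + ‖u₁ k‖) * latticeNorm k ^ (d + 1)) *
      assocFun M (ρ⁻¹ * latticeNorm k)) < ∞

end

end SemiDiscreteWave

open SemiDiscreteWave

namespace SemiDiscreteWave

/-! ### Energy estimates for a single mode -/

/-! The Fourier transform turns the lattice equation into the oscillators `v'' + a(t)² λ² v = 0`
with `λ = |ξ(θ)| ≤ 2 √d`, so the theorem reduces to a growth bound for one mode and a smallness
bound for the data near `θ = 0`.

Growth of a mode (`exists_mode_energy_le`). Time is split at `s = Λ⁻¹(N / λ)`. Before `s`, the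
energy of the limit equation with speed `a_∞` grows at rate at most `λ |a² - a_∞²| / a_∞`, and
stabilization bounds the total exponent by a multiple of `λ Θ(s)`. After `s`, the product `λ Ξ(t) ≥
λ Λ(t) / C₀` is large, and each derivative of `a` gains a factor `(λ Ξ)⁻¹`. Starting from `ψ = iλa`,
successive corrections solve the Riccati equation `ψ' + ψ² + λ² a² = 0` up to a residual `λ² O((λ
Ξ)^{-m})` (`exists_riccati_symbol`). The quadratic form attached to `ψ` is equivalent to `λ⁻¹` times
the energy and changes only through this residual (`RealMode.riccati_energy_le`). The exponent is
then `O(λ^{1-m} ∫_s^∞ Ξ^{-m})`, which the tail condition at `Λ(s) = N / λ` again bounds by a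
multiple of `λ Θ(s)`. Since `Θ / Λ` increases, every constant in front of `Θ(Λ⁻¹(N / λ))` can be
moved into `N` (`AdmissibleWeights.mul_comp_le`). Plancherel's identity then gives the energy
estimate.

Size of the data (`weightedEnergy_lt_top`). Vanishing moments permit subtracting the Taylor
polynomial of `e^{-ik·θ}` of any degree; with the decay condition the square root of the initial
energy density is at most `C (κλ)^n M_n / n!` for all `n ≥ 1`, where `κ = πρ/2`. Optimizing in `n`
gives `C / T[{M_j / j!}](1 / (κλ))`, which positivity of `L` bounds by a multiple of `exp (-κλ
Θ(Λ⁻¹(N / (κλ))))`. It remains to compare this exponent with `λ Θ(Λ⁻¹(N₀ / λ))`: in (i) `N` is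
adapted to `ρ`, in (ii) `ρ` is taken small.

To justify the transform, `u(t)` must be absolutely summable. Decay of `u₀` follows from decay of
its differences (`decay_of_fwdDiff_decay`), and a Gronwall estimate in weighted `ℓ²` propagates
polynomial decay in time (`IsSolution.pointwise_le`). -/

theorem le_mul_exp_integral_of_deriv_le {G G' κ : ℝ → ℝ} {s t : ℝ} (hst : s ≤ t)
    (hG : ContinuousOn G (Icc s t)) (hG' : ∀ x ∈ Ioo s t, HasDerivAt G (G' x) x)
    (hκ : ContinuousOn κ (Icc s t)) (h : ∀ x ∈ Ioo s t, G' x ≤ κ x * G x) :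
    G t ≤ G s * Real.exp (∫ x in s..t, κ x) := by
  have hint : IntervalIntegrable κ volume s t := by
    apply ContinuousOn.intervalIntegrable
    rwa [uIcc_of_le hst]
  have hK : ∀ x ∈ Ioo s t, HasDerivAt (fun y => ∫ z in s..y, κ z) (κ x) x := by
    intro x hx
    apply intervalIntegral.integral_hasDerivAt_right
    · apply ContinuousOn.intervalIntegrable
      rw [uIcc_of_le hx.1.le]
      exact hκ.mono (Icc_subset_Icc_right hx.2.le)
    · exact (hκ.mono Ioo_subset_Icc_self).stronglyMeasurableAtFilter isOpen_Ioo x hx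
    · exact hκ.continuousAt (Icc_mem_nhds hx.1 hx.2)
  have hKc : ContinuousOn (fun y => ∫ z in s..y, κ z) (Icc s t) := by
    have := intervalIntegral.continuousOn_primitive_interval (f := κ) (a := s) (b := t)
      (μ := volume) (by rw [uIcc_of_le hst]; exact hκ.integrableOn_Icc)
    rwa [uIcc_of_le hst] at this
  -- Integrating factor: `G` times `exp (-∫ κ)` has nonpositive derivative.
  have hd : ∀ x ∈ Ioo s t, HasDerivAt (fun y => G y * Real.exp (-∫ z in s..y, κ z))
      (G' x * Real.exp (-∫ z in s..x, κ z) +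
        G x * (Real.exp (-∫ z in s..x, κ z) * -κ x)) x := fun x hx =>
    (hG' x hx).mul (hK x hx).neg.exp
  have hanti : AntitoneOn (fun y => G y * Real.exp (-∫ z in s..y, κ z)) (Icc s t) := by
    apply antitoneOn_of_deriv_nonpos (convex_Icc s t)
    · exact hG.mul (Real.continuous_exp.comp_continuousOn hKc.neg)
    · rw [interior_Icc]
      exact fun x hx => (hd x hx).differentiableAt.differentiableWithinAt
    · rw [interior_Icc]
      intro x hx
      rw [(hd x hx).deriv]
      have := mul_le_mul_of_nonneg_right (h x hx) (Real.exp_pos (-∫ z in s..x, κ z)).le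
      linarith
  have := hanti (left_mem_Icc.2 hst) (right_mem_Icc.2 hst) hst
  simp only [intervalIntegral.integral_same, neg_zero, Real.exp_zero, mul_one] at this
  calc G t = G t * Real.exp (-∫ z in s..t, κ z) * Real.exp (∫ z in s..t, κ z) := by
        rw [mul_assoc, ← Real.exp_add]; simp
    _ ≤ _ := mul_le_mul_of_nonneg_right this (Real.exp_pos _).le

/-- A real solution `v`, with derivative `w`, of `v'' + a(t)² λ² v = 0` on `[0, ∞)`. -/
structure RealMode (a : ℝ → ℝ) (lam : ℝ) (v w : ℝ → ℝ) : Prop where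
  cont_pos : ContinuousOn v (Ici 0)
  cont_vel : ContinuousOn w (Ici 0)
  deriv_pos : ∀ t, 0 < t → HasDerivAt v (w t) t
  deriv_vel : ∀ t, 0 < t → HasDerivAt w (-(a t ^ 2 * lam ^ 2 * v t)) t

/-- With the constant speed `b` in the energy, the derivative is `2 λ² (b² - a²) v w`, and `2 b λ |v
w|` is at most the energy. No derivative of `a` enters, so the bound is usable at low frequency. -/
theorem RealMode.limit_energy_le {a : ℝ → ℝ} {lam b : ℝ} {v w : ℝ → ℝ}
    (h : RealMode a lam v w) (hlam : 0 ≤ lam) (hb : 0 < b) (ha : ContinuousOn a (Ici 0))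
    {t : ℝ} (ht : 0 ≤ t) :
    w t ^ 2 + b ^ 2 * lam ^ 2 * v t ^ 2 ≤ (w 0 ^ 2 + b ^ 2 * lam ^ 2 * v 0 ^ 2) *
      Real.exp (∫ x in (0 : ℝ)..t, lam * |a x ^ 2 - b ^ 2| / b) := by
  have hsub : Icc 0 t ⊆ Ici (0 : ℝ) := fun x hx => hx.1
  refine le_mul_exp_integral_of_deriv_le (G := fun t => w t ^ 2 + b ^ 2 * lam ^ 2 * v t ^ 2)
    (G' := fun t => 2 * lam ^ 2 * (b ^ 2 - a t ^ 2) * (v t * w t)) ht ?_ ?_ ?_ ?_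
  · have h1 := h.cont_pos.mono hsub
    have h2 := h.cont_vel.mono hsub
    fun_prop
  · intro x hx
    have := ((h.deriv_vel x hx.1).pow 2).add
      (((h.deriv_pos x hx.1).pow 2).const_mul (b ^ 2 * lam ^ 2))
    refine this.congr_deriv ?_
    push_cast
    ring
  · have h1 := ha.mono hsub
    fun_prop
  · intro x hx
    have h1 : 2 * b * lam * |v x * w x| ≤ w x ^ 2 + b ^ 2 * lam ^ 2 * v x ^ 2 := by
      rw [abs_mul]
      have := sq_nonneg (|w x| - b * lam * |v x|)
      have e1 := sq_abs (v x)
      have e2 := sq_abs (w x)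
      rw [← e1, ← e2]
      linarith
    have h2 : 2 * lam ^ 2 * (b ^ 2 - a x ^ 2) * (v x * w x) ≤
        2 * lam ^ 2 * (|a x ^ 2 - b ^ 2| * |v x * w x|) := by
      rw [mul_assoc, ← abs_mul]
      refine mul_le_mul_of_nonneg_left ?_ (by positivity)
      rw [← abs_neg]
      exact (le_of_eq (by ring)).trans (le_abs_self _)
    refine h2.trans ?_
    have h3 := mul_le_mul_of_nonneg_left h1 (by positivity : 0 ≤ lam * |a x ^ 2 - b ^ 2| / b)
    refine le_trans (le_of_eq ?_) h3
    field_simp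

/-- Energy estimate from an approximate solution `α + iβ` of the Riccati equation
`ψ' + ψ² + λ²a² = 0` with residual `R₁ + i R₂`. -/
theorem RealMode.riccati_energy_le {a : ℝ → ℝ} {lam : ℝ} {v w : ℝ → ℝ}
    (h : RealMode a lam v w) {α β R₁ R₂ κ : ℝ → ℝ} {s t : ℝ} (hs : 0 ≤ s) (hst : s ≤ t)
    (hα : ContinuousOn α (Icc s t)) (hβ : ContinuousOn β (Icc s t))
    (hκ : ContinuousOn κ (Icc s t))
    (hα' : ∀ x ∈ Ioo s t, HasDerivAt α (R₁ x - α x ^ 2 + β x ^ 2 - lam ^ 2 * a x ^ 2) x)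
    (hβ' : ∀ x ∈ Ioo s t, HasDerivAt β (R₂ x - 2 * α x * β x) x)
    (hβpos : ∀ x ∈ Icc s t, 0 < β x)
    (h1 : ∀ x ∈ Ioo s t, 4 * |R₁ x| ≤ κ x * β x) (h2 : ∀ x ∈ Ioo s t, 4 * |R₂ x| ≤ κ x * β x) :
    (w t - α t * v t) ^ 2 / β t + β t * v t ^ 2 ≤
      ((w s - α s * v s) ^ 2 / β s + β s * v s ^ 2) * Real.exp (∫ x in s..t, κ x) := by
  have hsub : Icc s t ⊆ Ici (0 : ℝ) := fun x hx => hs.trans hx.1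
  -- With `z = w - α v` one has `z' = -α z - (β² + R₁) v`. In the derivative of `z² / β + β v²` the
  -- terms in `α` and the cross terms `2 β v z` cancel, so every surviving term carries `R₁` or
  -- `R₂`.
  refine le_mul_exp_integral_of_deriv_le
    (G := fun t => (w t - α t * v t) ^ 2 / β t + β t * v t ^ 2)
    (G' := fun x => (-2 * R₁ x * (w x - α x * v x) * v x + 2 * β x * R₂ x * v x ^ 2
      - ((w x - α x * v x) ^ 2 + β x ^ 2 * v x ^ 2) * R₂ x / β x) / β x) hst ?_ ?_ hκ ?_
  · have h1 := h.cont_pos.mono hsub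
    have h2 := h.cont_vel.mono hsub
    refine ContinuousOn.add (ContinuousOn.div (by fun_prop) hβ fun x hx => (hβpos x hx).ne') ?_
    fun_prop
  · intro x hx
    have hb := (hβpos x (Ioo_subset_Icc_self hx)).ne'
    have hx0 : 0 < x := hs.trans_lt hx.1
    have e := (((((h.deriv_vel x hx0).sub ((hα' x hx).mul (h.deriv_pos x hx0))).pow 2).div
      (hβ' x hx) hb)).add ((hβ' x hx).mul ((h.deriv_pos x hx0).pow 2))
    refine e.congr_deriv ?_
    simp only [Pi.sub_apply, Pi.mul_apply, Pi.pow_apply]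
    field_simp
    push_cast
    ring
  · intro x hx
    have hb := hβpos x (Ioo_subset_Icc_self hx)
    set z := w x - α x * v x
    have k1 := h1 x hx
    have k2 := h2 x hx
    rw [div_le_iff₀ hb]
    have e1 : κ x * (z ^ 2 / β x + β x * v x ^ 2) * β x =
        κ x * β x * ((z ^ 2 + β x ^ 2 * v x ^ 2) / β x) := by field_simp
    rw [e1]
    set F := (z ^ 2 + β x ^ 2 * v x ^ 2) / β x with hF
    have hF0 : 0 ≤ F := by positivity
    have f1 : 2 * |z * v x| ≤ F := by
      rw [hF, le_div_iff₀ hb, abs_mul]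
      have := sq_nonneg (|z| - β x * |v x|)
      have e1 := sq_abs (v x)
      have e2 := sq_abs z
      rw [← e1, ← e2]
      linarith
    have f2 : β x * v x ^ 2 ≤ F := by
      rw [hF, le_div_iff₀ hb]
      nlinarith [sq_nonneg z]
    have g1 : -2 * R₁ x * z * v x ≤ |R₁ x| * F := by
      calc -2 * R₁ x * z * v x ≤ |-2 * R₁ x * z * v x| := le_abs_self _
        _ = |R₁ x| * (2 * |z * v x|) := by
          rw [show -2 * R₁ x * z * v x = (-2) * (R₁ x * (z * v x)) by ring, abs_mul, abs_mul]
          norm_num; ring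
        _ ≤ _ := mul_le_mul_of_nonneg_left f1 (abs_nonneg _)
    have g2 : 2 * β x * R₂ x * v x ^ 2 ≤ 2 * |R₂ x| * F := by
      calc 2 * β x * R₂ x * v x ^ 2 = 2 * R₂ x * (β x * v x ^ 2) := by ring
        _ ≤ 2 * |R₂ x| * (β x * v x ^ 2) := by
          refine mul_le_mul_of_nonneg_right ?_ (by positivity)
          linarith [le_abs_self (R₂ x)]
        _ ≤ _ := mul_le_mul_of_nonneg_left f2 (by positivity)
    have g3 : -((z ^ 2 + β x ^ 2 * v x ^ 2) * R₂ x / β x) ≤ |R₂ x| * F := by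
      rw [show (z ^ 2 + β x ^ 2 * v x ^ 2) * R₂ x / β x = R₂ x * F by rw [hF]; ring,
        ← neg_mul]
      exact mul_le_mul_of_nonneg_right (neg_le_abs _) hF0
    -- The total is at most `(|R₁| + 3 |R₂|) F`; the factor `4` in the hypotheses makes this `(1/4 +
    -- 3/4) κ β F`.
    have g4 := mul_le_mul_of_nonneg_right k1 hF0
    have g5 := mul_le_mul_of_nonneg_right k2 hF0
    linarith

end SemiDiscreteWave

namespace SemiDiscreteWave

/-! ### Symbols on the hyperbolic zone -/

/-- `‖f(λ, t)‖ ≤ C (λ Ξ(t))^{-k}` for `λ Ξ(t) ≥ 1`. -/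
def SymbolBound (Ξ : ℝ → ℝ) (k : ℕ) (f : ℝ → ℝ → ℂ) : Prop :=
  ∃ C : ℝ, 0 ≤ C ∧ ∀ lam t, 0 < lam → 0 ≤ t → 1 ≤ lam * Ξ t →
    ‖f lam t‖ ≤ C * ((lam * Ξ t) ^ k)⁻¹

/-- Symbols of order `-k` with `l` derivatives: each application of `λ⁻¹ ∂_t` gains one factor
`(λ Ξ(t))⁻¹` on the zone `λ Ξ(t) ≥ 1`. -/
def IsSymbol (Ξ : ℝ → ℝ) : ℕ → ℕ → (ℝ → ℝ → ℂ) → Prop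
  | 0, k, f => SymbolBound Ξ k f ∧ ∀ lam, 0 < lam → ContinuousOn (f lam) (Ici 0)
  | l + 1, k, f => SymbolBound Ξ k f ∧ ∃ g : ℝ → ℝ → ℂ,
      (∀ lam t, 0 < lam → 0 ≤ t → HasDerivWithinAt (f lam) (lam * g lam t) (Ici 0) t) ∧
      IsSymbol Ξ l (k + 1) g

variable {Ξ : ℝ → ℝ} {f g : ℝ → ℝ → ℂ} {k k' l : ℕ}

theorem SymbolBound.add (hf : SymbolBound Ξ k f) (hg : SymbolBound Ξ k g) :
    SymbolBound Ξ k (f + g) := by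
  obtain ⟨C, hC, hf⟩ := hf
  obtain ⟨D, hD, hg⟩ := hg
  refine ⟨C + D, by positivity, fun lam t h1 h2 h3 => ?_⟩
  rw [add_mul]
  exact (norm_add_le _ _).trans (add_le_add (hf lam t h1 h2 h3) (hg lam t h1 h2 h3))

theorem SymbolBound.mul (hf : SymbolBound Ξ k f) (hg : SymbolBound Ξ k' g) :
    SymbolBound Ξ (k + k') (f * g) := by
  obtain ⟨C, hC, hf⟩ := hf
  obtain ⟨D, hD, hg⟩ := hg
  refine ⟨C * D, by positivity, fun lam t h1 h2 h3 => ?_⟩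
  rw [Pi.mul_apply, Pi.mul_apply, norm_mul, pow_add, mul_inv]
  refine (mul_le_mul (hf lam t h1 h2 h3) (hg lam t h1 h2 h3) (norm_nonneg _) ?_).trans
    (le_of_eq (by ring))
  have : 0 < lam * Ξ t := by linarith
  positivity

theorem SymbolBound.mono (hf : SymbolBound Ξ k f) (h : k' ≤ k) : SymbolBound Ξ k' f := by
  obtain ⟨C, hC, hf⟩ := hf
  refine ⟨C, hC, fun lam t h1 h2 h3 => (hf lam t h1 h2 h3).trans ?_⟩
  refine mul_le_mul_of_nonneg_left ?_ hC
  exact inv_anti₀ (by positivity) (pow_le_pow_right₀ h3 h)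

theorem IsSymbol.bound (hf : IsSymbol Ξ l k f) : SymbolBound Ξ k f := by
  cases l with
  | zero => exact hf.1
  | succ l => exact hf.1

theorem IsSymbol.continuousOn (hf : IsSymbol Ξ l k f) {lam : ℝ} (hlam : 0 < lam) :
    ContinuousOn (f lam) (Ici 0) := by
  cases l with
  | zero => exact hf.2 lam hlam
  | succ l =>
    obtain ⟨-, g, hg, -⟩ := hf
    exact fun t ht => (hg lam t hlam ht).continuousWithinAt

theorem IsSymbol.mono (hf : IsSymbol Ξ l k f) (h : k' ≤ k) : IsSymbol Ξ l k' f := by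
  induction l generalizing k k' f with
  | zero => exact ⟨hf.1.mono h, hf.2⟩
  | succ l ih =>
    obtain ⟨hb, g, hd, hg⟩ := hf
    exact ⟨hb.mono h, g, hd, ih hg (by omega)⟩

theorem IsSymbol.of_succ (hf : IsSymbol Ξ (l + 1) k f) : IsSymbol Ξ l k f := by
  induction l generalizing k f with
  | zero => exact ⟨hf.bound, fun lam hlam => hf.continuousOn hlam⟩
  | succ l ih =>
    obtain ⟨hb, g, hd, hg⟩ := hf
    exact ⟨hb, g, hd, ih hg⟩

theorem IsSymbol.add (hf : IsSymbol Ξ l k f) (hg : IsSymbol Ξ l k g) :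
    IsSymbol Ξ l k (f + g) := by
  induction l generalizing k f g with
  | zero =>
    exact ⟨hf.1.add hg.1, fun lam hlam => (hf.2 lam hlam).add (hg.2 lam hlam)⟩
  | succ l ih =>
    obtain ⟨hb, f', hd, hf'⟩ := hf
    obtain ⟨hb2, g', hd2, hg'⟩ := hg
    refine ⟨hb.add hb2, f' + g', fun lam t h1 h2 => ?_, ih hf' hg'⟩
    refine ((hd lam t h1 h2).add (hd2 lam t h1 h2)).congr_deriv ?_
    simp only [Pi.add_apply]
    ring

theorem IsSymbol.mul (hf : IsSymbol Ξ l k f) (hg : IsSymbol Ξ l k' g) :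
    IsSymbol Ξ l (k + k') (f * g) := by
  induction l generalizing k k' f g with
  | zero =>
    exact ⟨hf.1.mul hg.1, fun lam hlam => (hf.2 lam hlam).mul (hg.2 lam hlam)⟩
  | succ l ih =>
    have hf0 := hf.of_succ
    have hg0 := hg.of_succ
    obtain ⟨hb, f', hd, hf'⟩ := hf
    obtain ⟨hb2, g', hd2, hg'⟩ := hg
    have e1 := ih hf' hg0
    have e2 := ih hf0 hg'
    rw [show k + 1 + k' = k + k' + 1 by ring] at e1
    rw [show k + (k' + 1) = k + k' + 1 by ring] at e2
    refine ⟨hb.mul hb2, f' * g + f * g', fun lam t h1 h2 => ?_, e1.add e2⟩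
    refine ((hd lam t h1 h2).mul (hd2 lam t h1 h2)).congr_deriv ?_
    simp only [Pi.add_apply, Pi.mul_apply]
    ring

theorem isSymbol_zero : IsSymbol Ξ l k 0 := by
  induction l generalizing k with
  | zero => exact ⟨⟨0, le_rfl, by simp⟩, fun _ _ => continuousOn_const⟩
  | succ l ih =>
    refine ⟨⟨0, le_rfl, by simp⟩, 0, fun lam t h1 h2 => ?_, ih⟩
    refine (hasDerivWithinAt_const t (Ici 0) (0 : ℂ)).congr_deriv ?_
    simp

theorem isSymbol_const (c : ℂ) : IsSymbol Ξ l 0 (fun _ _ => c) := by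
  cases l with
  | zero => exact ⟨⟨‖c‖, norm_nonneg _, by simp⟩, fun _ _ => continuousOn_const⟩
  | succ l =>
    refine ⟨⟨‖c‖, norm_nonneg _, by simp⟩, 0, fun lam t h1 h2 => ?_, isSymbol_zero⟩
    refine (hasDerivWithinAt_const t (Ici 0) c).congr_deriv ?_
    simp

theorem IsSymbol.const_mul (c : ℂ) (hf : IsSymbol Ξ l k f) :
    IsSymbol Ξ l k (fun lam t => c * f lam t) := by
  have := (isSymbol_const (Ξ := Ξ) (l := l) c).mul hf
  rwa [zero_add] at this

theorem IsSymbol.sub (hf : IsSymbol Ξ l k f) (hg : IsSymbol Ξ l k g) :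
    IsSymbol Ξ l k (f - g) := by
  have := hf.add (hg.const_mul (-1))
  convert this using 1
  ext lam t
  simp [sub_eq_add_neg]

/-- A coefficient whose derivatives satisfy symbol bounds is a symbol of order `0`. -/
theorem isSymbol_of_deriv_le {a : ℝ → ℝ} {m : ℕ} (hΞpos : ∀ t, 0 ≤ t → 0 < Ξ t)
    (ha : ContDiffOn ℝ m a (Ici 0)) {C : ℕ → ℝ}
    (hC : ∀ k, k ≤ m → ∀ t, 0 ≤ t →
      |iteratedDerivWithin k a (Ici 0) t| ≤ C k * (Ξ t ^ k)⁻¹) :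
    ∀ l k, k + l = m → IsSymbol Ξ l k
      (fun lam t => (((lam ^ k)⁻¹ * iteratedDerivWithin k a (Ici 0) t : ℝ) : ℂ)) := by
  have hb : ∀ k, k ≤ m → SymbolBound Ξ k
      (fun lam t => (((lam ^ k)⁻¹ * iteratedDerivWithin k a (Ici 0) t : ℝ) : ℂ)) := by
    intro k hk
    refine ⟨|C k|, abs_nonneg _, fun lam t h1 h2 h3 => ?_⟩
    rw [Complex.norm_real, Real.norm_eq_abs, abs_mul, abs_of_pos (by positivity), mul_pow,
      mul_inv, mul_left_comm]
    refine mul_le_mul_of_nonneg_left ((hC k hk t h2).trans ?_) (by positivity)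
    have := hΞpos t h2
    exact mul_le_mul_of_nonneg_right (le_abs_self _) (by positivity)
  intro l
  induction l with
  | zero =>
    intro k hk
    refine ⟨hb k (by omega), fun lam hlam => ?_⟩
    have := ha.continuousOn_iteratedDerivWithin (m := k) (by exact_mod_cast hk.le)
      (uniqueDiffOn_Ici 0)
    exact Complex.continuous_ofReal.comp_continuousOn (continuousOn_const.mul this)
  | succ l ih =>
    intro k hk
    refine ⟨hb k (by omega), _, fun lam t h1 h2 => ?_, ih (k + 1) (by omega)⟩
    have hd := ha.differentiableOn_iteratedDerivWithin (m := k)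
      (by exact_mod_cast (by omega : k < m)) (uniqueDiffOn_Ici 0) t h2
    have := (hd.hasDerivWithinAt.const_mul ((lam ^ k)⁻¹)).ofReal_comp
    refine this.congr_deriv ?_
    rw [iteratedDerivWithin_succ]
    push_cast
    have : (lam : ℂ) ≠ 0 := by exact_mod_cast h1.ne'
    field_simp
    ring

/-- The derivative `-g / f²` contains the inverse only with one derivative fewer, which the
induction on `l` already controls. -/
theorem IsSymbol.inv {δ : ℝ} (hδ : 0 < δ) (hf : IsSymbol Ξ l 0 f)
    (hlow : ∀ lam t, 0 < lam → 0 ≤ t → δ ≤ ‖f lam t‖) :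
    IsSymbol Ξ l 0 (fun lam t => (f lam t)⁻¹) := by
  have hne : ∀ lam t, 0 < lam → 0 ≤ t → f lam t ≠ 0 := fun lam t h1 h2 =>
    norm_pos_iff.1 (hδ.trans_le (hlow lam t h1 h2))
  have hb : SymbolBound Ξ 0 (fun lam t => (f lam t)⁻¹) := by
    refine ⟨δ⁻¹, by positivity, fun lam t h1 h2 h3 => ?_⟩
    rw [norm_inv]
    simpa using inv_anti₀ hδ (hlow lam t h1 h2)
  induction l with
  | zero => exact ⟨hb, fun lam h1 => (hf.2 lam h1).inv₀ fun t ht => hne lam t h1 ht⟩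
  | succ l ih =>
    have hi := ih hf.of_succ
    obtain ⟨-, g, hd, hg⟩ := hf
    have e := (hg.mul (hi.mul hi)).const_mul (-1)
    refine ⟨hb, _, fun lam t h1 h2 => ?_, e⟩
    refine ((hd lam t h1 h2).inv (hne lam t h1 h2)).congr_deriv ?_
    have := hne lam t h1 h2
    simp only [Pi.mul_apply]
    field_simp

/-- Approximate solutions of the rescaled Riccati equation `η' = -λ (η² + a²)`, with residual
of order `-(n+1)`. -/
theorem exists_riccati_symbol {a : ℝ → ℝ} {m : ℕ} {δ : ℝ} (hδ : 0 < δ)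
    (hlow : ∀ t, 0 ≤ t → δ ≤ a t) (ha : IsSymbol Ξ m 0 (fun _ t => (a t : ℂ))) :
    ∀ n l, n + l + 1 = m → ∃ η r : ℝ → ℝ → ℂ,
      IsSymbol Ξ (l + 1) 1 (fun lam t => η lam t - Complex.I * a t) ∧
      IsSymbol Ξ l (n + 1) r ∧
      ∀ lam t, 0 < lam → 0 ≤ t → HasDerivWithinAt (η lam)
        (lam * (r lam t - η lam t ^ 2 - (a t : ℂ) ^ 2)) (Ici 0) t := by
  have hdown : ∀ j l, l + j = m → IsSymbol Ξ l 0 (fun _ t => (a t : ℂ)) := by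
    intro j
    induction j with
    | zero => rintro l rfl; exact ha
    | succ j ih => exact fun l hl => (ih (l + 1) (by omega)).of_succ
  have hinv : ∀ l, l ≤ m → IsSymbol Ξ l 0 (fun _ t => (a t : ℂ)⁻¹) := by
    intro l hl
    refine (hdown (m - l) l (by omega)).inv hδ fun lam t h1 h2 => ?_
    rw [Complex.norm_real]
    exact (hlow t h2).trans (le_abs_self _)
  intro n
  induction n with
  | zero =>
    intro l hl
    obtain ⟨-, g, hd, hg⟩ := hdown 0 (l + 1) (by omega)
    -- The leading term `η = ia` satisfies `η² + a² = 0`, so its residual is `λ⁻¹ η'`, of order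
    -- `-1`.
    refine ⟨fun _ t => Complex.I * a t, fun lam t => Complex.I * g lam t, ?_, hg.const_mul _,
      fun lam t h1 h2 => ?_⟩
    · simp only [sub_self]
      exact isSymbol_zero
    · refine ((hd lam t h1 h2).const_mul Complex.I).congr_deriv ?_
      rw [mul_pow, Complex.I_sq]
      ring
  | succ n ih =>
    intro l hl
    obtain ⟨η, r, hη, hr, hd⟩ := ih (l + 1) (by omega)
    -- A Newton step: replacing `η` by `η - q` changes `η²` by `-2ηq + q²`, and `q` solves `2iaq =
    -- r`, with `ia` in place of `η`. The new residual is `-2 (η - ia) q + q² - λ⁻¹ q'`, one order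
    -- better; the derivative of `q` costs one of the available derivatives of `a`.
    set q : ℝ → ℝ → ℂ := fun lam t => (2 * Complex.I)⁻¹ * (r lam t * (a t : ℂ)⁻¹) with hqdef
    have hq : IsSymbol Ξ (l + 1) (n + 1) q :=
      (hr.mul (hinv (l + 1) (by omega))).const_mul ((2 * Complex.I)⁻¹)
    have hq0 := hq.of_succ
    obtain ⟨-, p, hqd, hp⟩ := id hq
    have e1 := ((hr.of_succ.mul (hη.of_succ.of_succ)).mul (hinv l (by omega))).const_mul
      (-Complex.I⁻¹)
    have e2 := (hq0.mul hq0).mono (k' := n + 1 + 1) (by omega)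
    have e3 := (e1.add e2).sub hp
    refine ⟨fun lam t => η lam t - q lam t, _, ?_, e3, fun lam t h1 h2 => ?_⟩
    · have := hη.of_succ.sub (hq.mono (by omega : 1 ≤ n + 1))
      convert this using 1
      ext lam t
      simp only [Pi.sub_apply]
      ring
    · refine ((hd lam t h1 h2).sub (hqd lam t h1 h2)).congr_deriv ?_
      have hane : (a t : ℂ) ≠ 0 := by exact_mod_cast (hδ.trans_le (hlow t h2)).ne'
      have hrq : r lam t = 2 * Complex.I * a t * q lam t := by
        simp only [hqdef]
        field_simp
      simp only [Pi.sub_apply, Pi.add_apply, Pi.mul_apply]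
      rw [hrq]
      field_simp
      ring

end SemiDiscreteWave

namespace SemiDiscreteWave

/-! ### The growth function `Θ ∘ Λ⁻¹` -/

/-- The monotonicity hypotheses on the pair `(Θ, Λ)`. -/
structure AdmissibleWeights (Θ Λ : ℝ → ℝ) : Prop where
  num_pos : ∀ t, 0 ≤ t → 0 < Θ t
  num_mono : MonotoneOn Θ (Ici 0)
  den_pos : ∀ t, 0 ≤ t → 0 < Λ t
  den_mono : StrictMonoOn Λ (Ici 0)
  den_cont : ContinuousOn Λ (Ici 0)
  den_lim : Tendsto Λ atTop atTop
  ratio_mono : MonotoneOn (fun t => Θ t / Λ t) (Ici 0)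

theorem halfLineInv_nonneg (Λ : ℝ → ℝ) (s : ℝ) : 0 ≤ halfLineInv Λ s :=
  Real.sSup_nonneg fun _ ht => ht.1

variable {Θ Λ : ℝ → ℝ}

theorem AdmissibleWeights.apply_inv (h : AdmissibleWeights Θ Λ) {s : ℝ} (hs : Λ 0 ≤ s) :
    Λ (halfLineInv Λ s) = s := by
  obtain ⟨T, hT⟩ := ((h.den_lim.eventually_ge_atTop s).and (eventually_ge_atTop 0)).exists
  obtain ⟨t, ht, rfl⟩ := intermediate_value_Icc hT.2
    (h.den_cont.mono fun x hx => hx.1) ⟨hs, hT.1⟩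
  rw [halfLineInv_apply h.den_mono ht.1]

theorem AdmissibleWeights.inv_mono (h : AdmissibleWeights Θ Λ) : Monotone (halfLineInv Λ) := by
  intro s s' hs
  rcases lt_or_ge s (Λ 0) with h0 | h0
  · rw [halfLineInv_of_lt h.den_mono h0]
    exact halfLineInv_nonneg _ _
  · rw [← h.den_mono.le_iff_le (halfLineInv_nonneg _ _) (halfLineInv_nonneg _ _),
      h.apply_inv h0, h.apply_inv (h0.trans hs)]
    exact hs

theorem AdmissibleWeights.comp_mono (h : AdmissibleWeights Θ Λ) :
    Monotone fun s => Θ (halfLineInv Λ s) := fun _ _ hs =>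
  h.num_mono (halfLineInv_nonneg _ _) (halfLineInv_nonneg _ _) (h.inv_mono hs)

/-- Monotonicity of `Θ / Λ` at `Λ⁻¹(s) ≤ Λ⁻¹(K s)`. This is the device that absorbs multiplicative
constants in exponents into the parameter `N`. -/
theorem AdmissibleWeights.mul_comp_le (h : AdmissibleWeights Θ Λ) {K s : ℝ} (hK : 1 ≤ K)
    (hs : Λ 0 ≤ s) : K * Θ (halfLineInv Λ s) ≤ Θ (halfLineInv Λ (K * s)) := by
  have hs0 : 0 < s := (h.den_pos 0 le_rfl).trans_le hs
  have hKs : s ≤ K * s := le_mul_of_one_le_left hs0.le hK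
  have := h.ratio_mono (halfLineInv_nonneg Λ s) (halfLineInv_nonneg Λ (K * s)) (h.inv_mono hKs)
  simp only [h.apply_inv hs, h.apply_inv (hs.trans hKs)] at this
  rw [div_le_div_iff₀ hs0 (by positivity)] at this
  nlinarith

/-! ### Growth of a single mode -/

/-- `RealMode.riccati_energy_le` is applied to `ψ = λ η`, with `η` the approximate Riccati solution
after `m - 1` corrections; its residual has order `-m`, which is why the integral of `Ξ^{-m}`
appears. -/
theorem exists_hyperbolic_energy_le {a Ξ : ℝ → ℝ} {m : ℕ} (hm : 1 ≤ m) {δ a₁ : ℝ} (hδ : 0 < δ)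
    (hlow : ∀ t, 0 ≤ t → δ ≤ a t) (hup : ∀ t, 0 ≤ t → a t ≤ a₁)
    (hΞpos : ∀ t, 0 ≤ t → 0 < Ξ t) (hΞmono : MonotoneOn Ξ (Ici 0))
    (ha : IsSymbol Ξ m 0 (fun _ t => (a t : ℂ)))
    (hΞint : IntegrableOn (fun s => (Ξ s ^ m)⁻¹) (Ioi 0)) :
    ∃ K B : ℝ, 1 ≤ K ∧ 0 ≤ B ∧ ∀ lam s : ℝ, 0 < lam → 0 ≤ s → K ≤ lam * Ξ s →
      ∀ v w : ℝ → ℝ, RealMode a lam v w → ∀ t, s ≤ t →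
        w t ^ 2 + a t ^ 2 * lam ^ 2 * v t ^ 2 ≤ B * (w s ^ 2 + a s ^ 2 * lam ^ 2 * v s ^ 2) *
          Real.exp (B * (lam * ((lam ^ m)⁻¹ * ∫ x in Ioi s, (Ξ x ^ m)⁻¹))) := by
  obtain ⟨η, r, hη, hr, hd⟩ := exists_riccati_symbol hδ hlow ha (m - 1) 0 (by omega)
  rw [show m - 1 + 1 = m by omega] at hr
  obtain ⟨C₁, hC₁, hb₁⟩ := hη.bound
  obtain ⟨C₂, hC₂, hb₂⟩ := hr.bound
  have ha₁ : δ ≤ a₁ := (hlow 0 le_rfl).trans (hup 0 le_rfl)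
  have ha₁0 : 0 < a₁ := hδ.trans_le ha₁
  -- The bound `λ Ξ ≥ 2 C₁ / δ` forces `|η - ia| ≤ δ / 2`. The number `54 a₁ / δ` is `6 · (3 a₁ / 2)
  -- · 3 · (2 / δ)`, from comparing the quadratic form with the energy at both ends; `8 C₂ / δ`
  -- comes from integrating the growth rate.
  refine ⟨max 1 (2 * C₁ / δ), max (54 * a₁ / δ) (8 * C₂ / δ), le_max_left _ _, ?_, ?_⟩
  · exact le_max_of_le_left (by positivity)
  intro lam s hlam hs hK v w hvw t hst
  have hzone : ∀ x, s ≤ x → 1 ≤ lam * Ξ x ∧ 2 * C₁ / δ ≤ lam * Ξ x := by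
    intro x hx
    have : lam * Ξ s ≤ lam * Ξ x :=
      mul_le_mul_of_nonneg_left (hΞmono hs (hs.trans hx) hx) hlam.le
    exact ⟨(le_max_left _ _).trans (hK.trans this), (le_max_right _ _).trans (hK.trans this)⟩
  have hclose : ∀ x, s ≤ x → ‖η lam x - Complex.I * a x‖ ≤ δ / 2 := by
    intro x hx
    refine (hb₁ lam x hlam (hs.trans hx) (hzone x hx).1).trans ?_
    have h1 := (hzone x hx).1
    have h2 := (hzone x hx).2
    rw [pow_one, ← div_eq_mul_inv, div_le_div_iff₀ (by linarith) two_pos]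
    rw [div_le_iff₀ hδ] at h2
    linarith
  have hre : ∀ x, s ≤ x → |(η lam x).re| ≤ a x / 2 := by
    intro x hx
    have h1 := (Complex.abs_re_le_norm _).trans (hclose x hx)
    have h2 := hlow x (hs.trans hx)
    have : (η lam x - Complex.I * a x).re = (η lam x).re := by simp
    rw [this] at h1
    linarith
  have him : ∀ x, s ≤ x → a x / 2 ≤ (η lam x).im ∧ (η lam x).im ≤ 3 * a x / 2 := by
    intro x hx
    have h1 := (Complex.abs_im_le_norm _).trans (hclose x hx)
    have h2 := hlow x (hs.trans hx)
    have : (η lam x - Complex.I * a x).im = (η lam x).im - a x := by simp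
    rw [this, abs_le] at h1
    constructor <;> linarith
  have hsub : Icc s t ⊆ Ici (0 : ℝ) := fun x hx => hs.trans hx.1
  have hηc : ContinuousOn (η lam) (Icc s t) := fun x hx =>
    ((hd lam x hlam (hsub hx)).continuousWithinAt).mono hsub
  have hrc : ContinuousOn (r lam) (Icc s t) := (hr.continuousOn hlam).mono hsub
  have hre_c : ContinuousOn (fun x => (η lam x).re) (Icc s t) :=
    Complex.continuous_re.comp_continuousOn hηc
  have him_c : ContinuousOn (fun x => (η lam x).im) (Icc s t) :=
    Complex.continuous_im.comp_continuousOn hηc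
  have hκ_c : ContinuousOn (fun x => 8 * lam / δ * ‖r lam x‖) (Icc s t) :=
    continuousOn_const.mul hrc.norm
  have hηd : ∀ x ∈ Ioo s t,
      HasDerivAt (η lam) (lam * (r lam x - η lam x ^ 2 - (a x : ℂ) ^ 2)) x := fun x hx =>
    (hd lam x hlam (hs.trans hx.1.le)).hasDerivAt (Ici_mem_nhds (hs.trans_lt hx.1))
  have hred : ∀ x ∈ Ioo s t, HasDerivAt (fun x => (η lam x).re)
      (lam * (r lam x - η lam x ^ 2 - (a x : ℂ) ^ 2)).re x := fun x hx =>
    Complex.reCLM.hasFDerivAt.comp_hasDerivAt x (hηd x hx)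
  have himd : ∀ x ∈ Ioo s t, HasDerivAt (fun x => (η lam x).im)
      (lam * (r lam x - η lam x ^ 2 - (a x : ℂ) ^ 2)).im x := fun x hx =>
    Complex.imCLM.hasFDerivAt.comp_hasDerivAt x (hηd x hx)
  have hβlow : ∀ x, s ≤ x → lam * δ / 2 ≤ lam * (η lam x).im := by
    intro x hx
    have h1 := (him x hx).1
    have h2 := hlow x (hs.trans hx)
    nlinarith
  have key := hvw.riccati_energy_le (α := fun x => lam * (η lam x).re)
    (β := fun x => lam * (η lam x).im) (R₁ := fun x => lam ^ 2 * (r lam x).re)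
    (R₂ := fun x => lam ^ 2 * (r lam x).im) (κ := fun x => 8 * lam / δ * ‖r lam x‖) hs hst
    (continuousOn_const.mul hre_c) (continuousOn_const.mul him_c) hκ_c ?_ ?_ ?_ ?_ ?_
  rotate_left
  · intro x hx
    refine ((hred x hx).const_mul lam).congr_deriv ?_
    simp [pow_two]
    ring
  · intro x hx
    refine ((himd x hx).const_mul lam).congr_deriv ?_
    simp [pow_two]
    ring
  · intro x hx
    exact lt_of_lt_of_le (by positivity) (hβlow x hx.1)
  · intro x hx
    have h1 := hβlow x hx.1.le
    have h2 := Complex.abs_re_le_norm (r lam x)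
    rw [abs_mul, abs_of_pos (by positivity)]
    calc 4 * (lam ^ 2 * |(r lam x).re|) ≤ 4 * (lam ^ 2 * ‖r lam x‖) := by gcongr
      _ = 8 * lam / δ * ‖r lam x‖ * (lam * δ / 2) := by field_simp; ring
      _ ≤ _ := by gcongr
  · intro x hx
    have h1 := hβlow x hx.1.le
    have h2 := Complex.abs_im_le_norm (r lam x)
    rw [abs_mul, abs_of_pos (by positivity)]
    calc 4 * (lam ^ 2 * |(r lam x).im|) ≤ 4 * (lam ^ 2 * ‖r lam x‖) := by gcongr
      _ = 8 * lam / δ * ‖r lam x‖ * (lam * δ / 2) := by field_simp; ring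
      _ ≤ _ := by gcongr
  have hexp : ∫ x in s..t, 8 * lam / δ * ‖r lam x‖ ≤
      max (54 * a₁ / δ) (8 * C₂ / δ) * (lam * ((lam ^ m)⁻¹ * ∫ x in Ioi s, (Ξ x ^ m)⁻¹)) := by
    have hints : IntegrableOn (fun x => (Ξ x ^ m)⁻¹) (Ioi s) :=
      hΞint.mono_set (Ioi_subset_Ioi hs)
    have hint2 : IntervalIntegrable (fun x => (Ξ x ^ m)⁻¹) volume s t := by
      rw [intervalIntegrable_iff_integrableOn_Ioc_of_le hst]
      exact hints.mono_set Ioc_subset_Ioi_self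
    have hnn : ∀ x, s ≤ x → 0 ≤ (Ξ x ^ m)⁻¹ := fun x hx => by
      have := hΞpos x (hs.trans hx)
      positivity
    have h1 : ∫ x in s..t, 8 * lam / δ * ‖r lam x‖ ≤
        ∫ x in s..t, 8 * lam / δ * C₂ * (lam ^ m)⁻¹ * (Ξ x ^ m)⁻¹ := by
      refine intervalIntegral.integral_mono_on hst ?_ (hint2.const_mul _) ?_
      · apply ContinuousOn.intervalIntegrable
        rwa [uIcc_of_le hst]
      · intro x hx
        have := hb₂ lam x hlam (hs.trans hx.1) (hzone x hx.1).1
        rw [mul_pow, mul_inv] at this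
        calc 8 * lam / δ * ‖r lam x‖ ≤
            8 * lam / δ * (C₂ * ((lam ^ m)⁻¹ * (Ξ x ^ m)⁻¹)) := by gcongr
          _ = _ := by ring
    have h2 : ∫ x in s..t, (Ξ x ^ m)⁻¹ ≤ ∫ x in Ioi s, (Ξ x ^ m)⁻¹ := by
      rw [intervalIntegral.integral_of_le hst]
      refine setIntegral_mono_set hints ?_ Ioc_subset_Ioi_self.eventuallyLE
      exact (ae_restrict_iff' measurableSet_Ioi).2 (.of_forall fun x hx => hnn x (le_of_lt hx))
    have h3 : 0 ≤ ∫ x in Ioi s, (Ξ x ^ m)⁻¹ :=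
      setIntegral_nonneg measurableSet_Ioi fun x hx => hnn x (le_of_lt hx)
    rw [intervalIntegral.integral_const_mul (8 * lam / δ * C₂ * (lam ^ m)⁻¹)] at h1
    calc _ ≤ _ := h1
      _ ≤ 8 * lam / δ * C₂ * (lam ^ m)⁻¹ * ∫ x in Ioi s, (Ξ x ^ m)⁻¹ := by gcongr
      _ = 8 * C₂ / δ * (lam * ((lam ^ m)⁻¹ * ∫ x in Ioi s, (Ξ x ^ m)⁻¹)) := by ring
      _ ≤ _ := by
        gcongr
        exact le_max_right _ _
  set X := max (54 * a₁ / δ) (8 * C₂ / δ) * (lam * ((lam ^ m)⁻¹ * ∫ x in Ioi s, (Ξ x ^ m)⁻¹))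
  have hβpos : ∀ x, s ≤ x → 0 < lam * (η lam x).im := fun x hx =>
    lt_of_lt_of_le (by positivity) (hβlow x hx)
  set G : ℝ → ℝ := fun x => (w x - lam * (η lam x).re * v x) ^ 2 / (lam * (η lam x).im) +
    lam * (η lam x).im * v x ^ 2 with hGdef
  have hβG : ∀ x, s ≤ x → lam * (η lam x).im * G x =
      (w x - lam * (η lam x).re * v x) ^ 2 + (lam * (η lam x).im * v x) ^ 2 := by
    intro x hx
    have h1 := right_ne_zero_of_mul (hβpos x hx).ne'
    simp only [hGdef]
    field_simp
  -- The inequalities `|Re η| ≤ a / 2` and `a / 2 ≤ Im η ≤ 3a / 2` make `λ (Im η) G` equivalent to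
  -- the energy.
  have hcmp : ∀ x, s ≤ x →
      w x ^ 2 + a x ^ 2 * lam ^ 2 * v x ^ 2 ≤ 6 * (lam * (η lam x).im * G x) ∧
      lam * (η lam x).im * G x ≤ 3 * (w x ^ 2 + a x ^ 2 * lam ^ 2 * v x ^ 2) := by
    intro x hx
    rw [hβG x hx]
    have hax : 0 < a x := hδ.trans_le (hlow x (hs.trans hx))
    have h1 : (lam * (η lam x).re * v x) ^ 2 ≤ a x ^ 2 * lam ^ 2 * v x ^ 2 / 4 := by
      have : (η lam x).re ^ 2 ≤ (a x / 2) ^ 2 := sq_le_sq' (by linarith [(abs_le.1 (hre x hx)).1])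
        (abs_le.1 (hre x hx)).2
      calc (lam * (η lam x).re * v x) ^ 2 = (lam * v x) ^ 2 * (η lam x).re ^ 2 := by ring
        _ ≤ (lam * v x) ^ 2 * (a x / 2) ^ 2 := by gcongr
        _ = _ := by ring
    have h2 : a x ^ 2 * lam ^ 2 * v x ^ 2 / 4 ≤ (lam * (η lam x).im * v x) ^ 2 := by
      have : (a x / 2) ^ 2 ≤ (η lam x).im ^ 2 := pow_le_pow_left₀ (by positivity) (him x hx).1 2
      calc _ = (lam * v x) ^ 2 * (a x / 2) ^ 2 := by ring
        _ ≤ (lam * v x) ^ 2 * (η lam x).im ^ 2 := by gcongr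
        _ = _ := by ring
    have h3 : (lam * (η lam x).im * v x) ^ 2 ≤ 9 / 4 * (a x ^ 2 * lam ^ 2 * v x ^ 2) := by
      have : (η lam x).im ^ 2 ≤ (3 * a x / 2) ^ 2 :=
        pow_le_pow_left₀ (by linarith [(him x hx).1]) (him x hx).2 2
      calc _ = (lam * v x) ^ 2 * (η lam x).im ^ 2 := by ring
        _ ≤ (lam * v x) ^ 2 * (3 * a x / 2) ^ 2 := by gcongr
        _ = _ := by ring
    set y := lam * (η lam x).re * v x
    constructor
    · nlinarith [sq_nonneg (w x - 2 * y), sq_nonneg (w x - y)]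
    · nlinarith [sq_nonneg (w x + y)]
  have hE0 : 0 ≤ w s ^ 2 + a s ^ 2 * lam ^ 2 * v s ^ 2 := by positivity
  have hGs : G s ≤ 3 * (w s ^ 2 + a s ^ 2 * lam ^ 2 * v s ^ 2) / (lam * δ / 2) := by
    have h1 := (hcmp s le_rfl).2
    have h2 := hβlow s le_rfl
    rw [le_div_iff₀ (by positivity)]
    have : 0 ≤ G s := by
      have := hβpos s le_rfl
      simp only [hGdef]
      positivity
    nlinarith
  calc w t ^ 2 + a t ^ 2 * lam ^ 2 * v t ^ 2 ≤ 6 * (lam * (η lam t).im * G t) := (hcmp t hst).1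
    _ ≤ 6 * ((lam * (3 * a₁ / 2)) * (G s * Real.exp X)) := by
      have h1 : G t ≤ G s * Real.exp X := by
        refine key.trans ?_
        have := hβpos s le_rfl
        gcongr
      have h2 : (η lam t).im ≤ 3 * a₁ / 2 := by
        have := (him t hst).2
        have := hup t (hs.trans hst)
        linarith
      have h3 := hβpos t hst
      have h4 : 0 ≤ G t := by
        simp only [hGdef]
        positivity
      gcongr
    _ ≤ 6 * ((lam * (3 * a₁ / 2)) *
        (3 * (w s ^ 2 + a s ^ 2 * lam ^ 2 * v s ^ 2) / (lam * δ / 2) * Real.exp X)) := by gcongr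
    _ = 54 * a₁ / δ * (w s ^ 2 + a s ^ 2 * lam ^ 2 * v s ^ 2) * Real.exp X := by
      field_simp
      ring
    _ ≤ _ := by
      gcongr
      exact le_max_left _ _

/-- Energy growth of a single mode of frequency `0 ≤ λ ≤ b`. -/
theorem exists_mode_energy_le {a Θ Ξ Λ : ℝ → ℝ} {m : ℕ} (hm : 1 ≤ m) {δ a₁ aInf b C₀ K : ℝ}
    (hδ : 0 < δ) (hlow : ∀ t, 0 ≤ t → δ ≤ a t) (hup : ∀ t, 0 ≤ t → a t ≤ a₁)
    (hac : ContinuousOn a (Ici 0))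
    (hΞpos : ∀ t, 0 ≤ t → 0 < Ξ t) (hΞmono : MonotoneOn Ξ (Ici 0))
    (ha : IsSymbol Ξ m 0 (fun _ t => (a t : ℂ))) (hW : AdmissibleWeights Θ Λ)
    (hInf : 0 < aInf) (hstab : ∀ t, 0 ≤ t → (∫ s in (0 : ℝ)..t, |a s - aInf|) ≤ Θ t)
    (hC₀ : 0 < C₀) (hΛΞ : ∀ t, 0 ≤ t → Λ t ≤ C₀ * Ξ t)
    (hΞint : IntegrableOn (fun s => (Ξ s ^ m)⁻¹) (Ioi 0))
    (hΞtail : ∀ t, 0 ≤ t → Λ t ^ m * (Θ t)⁻¹ * (∫ s in Ioi t, (Ξ s ^ m)⁻¹) ≤ K) :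
    ∃ N B : ℝ, 1 ≤ N ∧ b * Λ 0 ≤ N ∧ 0 ≤ B ∧ ∀ lam : ℝ, 0 ≤ lam → lam ≤ b →
      ∀ v w : ℝ → ℝ, RealMode a lam v w → ∀ t, 0 ≤ t →
        w t ^ 2 + a t ^ 2 * lam ^ 2 * v t ^ 2 ≤
          B * Real.exp (2 * lam * Θ (halfLineInv Λ (N / lam))) *
            (w 0 ^ 2 + a 0 ^ 2 * lam ^ 2 * v 0 ^ 2) := by
  obtain ⟨K₁, B₁, hK₁, hB₁, hyp⟩ :=
    exists_hyperbolic_energy_le hm hδ hlow hup hΞpos hΞmono ha hΞint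
  have ha₁ : δ ≤ a₁ := (hlow 0 le_rfl).trans (hup 0 le_rfl)
  have ha₁0 : 0 < a₁ := hδ.trans_le ha₁
  set P := (a₁ + aInf) / aInf with hP
  have hP0 : 0 < P := by positivity
  -- comparison with the energy of the limit equation, and its growth
  have zone1 : ∀ lam : ℝ, 0 ≤ lam → ∀ v w : ℝ → ℝ, RealMode a lam v w → ∀ t, 0 ≤ t →
      w t ^ 2 + a t ^ 2 * lam ^ 2 * v t ^ 2 ≤
        (1 + a₁ ^ 2 / aInf ^ 2) * (1 + aInf ^ 2 / δ ^ 2) *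
          (w 0 ^ 2 + a 0 ^ 2 * lam ^ 2 * v 0 ^ 2) * Real.exp (P * (lam * Θ t)) := by
    intro lam hlam v w hvw t ht
    have h1 := hvw.limit_energy_le hlam hInf hac ht
    have hat : 0 < a t := hδ.trans_le (hlow t ht)
    have h2 : w t ^ 2 + a t ^ 2 * lam ^ 2 * v t ^ 2 ≤
        (1 + a₁ ^ 2 / aInf ^ 2) * (w t ^ 2 + aInf ^ 2 * lam ^ 2 * v t ^ 2) := by
      have : a t ^ 2 ≤ a₁ ^ 2 := pow_le_pow_left₀ hat.le (hup t ht) 2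
      calc w t ^ 2 + a t ^ 2 * lam ^ 2 * v t ^ 2
          ≤ w t ^ 2 + a₁ ^ 2 * lam ^ 2 * v t ^ 2 := by gcongr
        _ ≤ w t ^ 2 + a₁ ^ 2 * lam ^ 2 * v t ^ 2 +
            (a₁ ^ 2 / aInf ^ 2 * w t ^ 2 + aInf ^ 2 * lam ^ 2 * v t ^ 2) :=
          le_add_of_nonneg_right (by positivity)
        _ = _ := by field_simp; ring
    have h3 : w 0 ^ 2 + aInf ^ 2 * lam ^ 2 * v 0 ^ 2 ≤
        (1 + aInf ^ 2 / δ ^ 2) * (w 0 ^ 2 + a 0 ^ 2 * lam ^ 2 * v 0 ^ 2) := by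
      have : δ ^ 2 ≤ a 0 ^ 2 := pow_le_pow_left₀ hδ.le (hlow 0 le_rfl) 2
      have h4 : w 0 ^ 2 + aInf ^ 2 * lam ^ 2 * v 0 ^ 2 ≤
          (1 + aInf ^ 2 / δ ^ 2) * (w 0 ^ 2 + δ ^ 2 * lam ^ 2 * v 0 ^ 2) := by
        calc _ ≤ w 0 ^ 2 + aInf ^ 2 * lam ^ 2 * v 0 ^ 2 +
              (aInf ^ 2 / δ ^ 2 * w 0 ^ 2 + δ ^ 2 * lam ^ 2 * v 0 ^ 2) :=
            le_add_of_nonneg_right (by positivity)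
          _ = _ := by field_simp; ring
      refine h4.trans ?_
      gcongr
    have h4 : ∫ x in (0 : ℝ)..t, lam * |a x ^ 2 - aInf ^ 2| / aInf ≤ P * (lam * Θ t) := by
      have hsub : uIcc 0 t ⊆ Ici (0 : ℝ) := by
        rw [uIcc_of_le ht]
        exact fun x hx => hx.1
      have hac' := hac.mono hsub
      have i1 : IntervalIntegrable (fun x => lam * |a x ^ 2 - aInf ^ 2| / aInf) volume 0 t := by
        apply ContinuousOn.intervalIntegrable
        fun_prop
      have i2 : IntervalIntegrable (fun x => |a x - aInf|) volume 0 t := by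
        apply ContinuousOn.intervalIntegrable
        fun_prop
      have := intervalIntegral.integral_mono_on ht i1 (i2.const_mul (P * lam)) ?_
      · rw [intervalIntegral.integral_const_mul] at this
        refine this.trans ?_
        rw [← mul_assoc]
        exact mul_le_mul_of_nonneg_left (hstab t ht) (by positivity)
      · intro x hx
        have hx0 := hlow x hx.1
        have hx1 := hup x hx.1
        rw [show a x ^ 2 - aInf ^ 2 = (a x + aInf) * (a x - aInf) by ring, abs_mul,
          abs_of_pos (by linarith : 0 < a x + aInf)]
        calc lam * ((a x + aInf) * |a x - aInf|) / aInf
            ≤ lam * ((a₁ + aInf) * |a x - aInf|) / aInf := by gcongr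
          _ = _ := by rw [hP]; ring
    calc _ ≤ _ := h2
      _ ≤ (1 + a₁ ^ 2 / aInf ^ 2) * ((w 0 ^ 2 + aInf ^ 2 * lam ^ 2 * v 0 ^ 2) *
          Real.exp (∫ x in (0 : ℝ)..t, lam * |a x ^ 2 - aInf ^ 2| / aInf)) := by gcongr
      _ ≤ (1 + a₁ ^ 2 / aInf ^ 2) * (((1 + aInf ^ 2 / δ ^ 2) *
          (w 0 ^ 2 + a 0 ^ 2 * lam ^ 2 * v 0 ^ 2)) * Real.exp (P * (lam * Θ t))) := by gcongr
      _ = _ := by ring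
  set D := (1 + a₁ ^ 2 / aInf ^ 2) * (1 + aInf ^ 2 / δ ^ 2) with hD
  have hD1 : 0 ≤ D := by positivity
  -- `K₁ C₀ ≤ N` puts the times after `s` in the hyperbolic zone, `b Λ(0) ≤ N` gives `Λ(s) = N / λ`
  -- for all `λ ≤ b`, and `1 ≤ N` permits dropping the factor `N ^ m` in the tail estimate.
  set N := max 1 (max (K₁ * C₀) (b * Λ 0)) with hN
  have hN1 : 1 ≤ N := le_max_left _ _
  have hN2 : K₁ * C₀ ≤ N := (le_max_left _ _).trans (le_max_right _ _)
  have hN3 : b * Λ 0 ≤ N := (le_max_right _ _).trans (le_max_right _ _)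
  -- The exponents before and after `s` add up to at most `(P + B₁ |K|) λ Θ(s)`; the factor `Q` is
  -- then moved inside `Λ⁻¹`, so the final parameter is `Q N`.
  set Q := max 1 (P + B₁ * |K|) with hQ
  have hQ1 : 1 ≤ Q := le_max_left _ _
  have hNQ : N ≤ Q * N := le_mul_of_one_le_left (by linarith) hQ1
  refine ⟨Q * N, max 1 B₁ * D, hN1.trans hNQ, hN3.trans hNQ, by positivity, ?_⟩
  intro lam hlam hlamb v w hvw t ht
  have hE0 : 0 ≤ w 0 ^ 2 + a 0 ^ 2 * lam ^ 2 * v 0 ^ 2 := by positivity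
  have hmax : 1 ≤ max 1 B₁ := le_max_left _ _
  rcases hlam.eq_or_lt with rfl | hlam0
  · have := zone1 0 le_rfl v w hvw t ht
    simp only [zero_mul, mul_zero, Real.exp_zero, mul_one] at this ⊢
    refine this.trans (mul_le_mul_of_nonneg_right ?_ hE0)
    exact le_mul_of_one_le_left hD1 hmax
  set s := halfLineInv Λ (N / lam) with hs
  have hs0 : 0 ≤ s := halfLineInv_nonneg _ _
  have hΛ0 := hW.den_pos 0 le_rfl
  have hNl : Λ 0 ≤ N / lam := by
    rw [le_div_iff₀ hlam0, mul_comm]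
    exact (mul_le_mul_of_nonneg_right hlamb hΛ0.le).trans hN3
  have hΛs : Λ s = N / lam := hW.apply_inv hNl
  have hΘs := hW.num_pos s hs0
  have hexp : (P + B₁ * |K|) * (lam * Θ s) ≤
      2 * lam * Θ (halfLineInv Λ (Q * N / lam)) := by
    have h1 := hW.mul_comp_le hQ1 hNl
    rw [← hs, ← mul_div_assoc] at h1
    have hpos := hW.num_pos _ (halfLineInv_nonneg Λ (Q * N / lam))
    calc _ ≤ Q * (lam * Θ s) := by
          gcongr
          exact le_max_right _ _
      _ = lam * (Q * Θ s) := by ring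
      _ ≤ lam * Θ (halfLineInv Λ (Q * N / lam)) := by gcongr
      _ ≤ _ := by nlinarith [mul_pos hlam0 hpos]
  rcases le_total t s with hts | hst
  · have h1 := hW.num_mono ht hs0 hts
    calc _ ≤ _ := zone1 lam hlam v w hvw t ht
      _ ≤ D * (w 0 ^ 2 + a 0 ^ 2 * lam ^ 2 * v 0 ^ 2) *
          Real.exp ((P + B₁ * |K|) * (lam * Θ s)) := by
        have h0 := hW.num_pos t ht
        have : P ≤ P + B₁ * |K| := le_add_of_nonneg_right (by positivity)
        gcongr
      _ ≤ (max 1 B₁ * D) * (w 0 ^ 2 + a 0 ^ 2 * lam ^ 2 * v 0 ^ 2) *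
          Real.exp (2 * lam * Θ (halfLineInv Λ (Q * N / lam))) := by
        gcongr
        exact le_mul_of_one_le_left hD1 hmax
      _ = _ := by ring
  · have hK : K₁ ≤ lam * Ξ s := by
      have h1 := hΛΞ s hs0
      rw [hΛs, div_le_iff₀ hlam0] at h1
      have : K₁ * C₀ ≤ (lam * Ξ s) * C₀ := by linarith
      exact le_of_mul_le_mul_right this hC₀
    have h1 := hyp lam s hlam0 hs0 hK v w hvw t hst
    have h2 := zone1 lam hlam v w hvw s hs0
    -- The tail condition at time `s`, where `Λ(s) ^ m = N ^ m / λ ^ m`.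
    have h3 : lam * ((lam ^ m)⁻¹ * ∫ x in Ioi s, (Ξ x ^ m)⁻¹) ≤ |K| * (lam * Θ s) := by
      have h4 := (hΞtail s hs0).trans (le_abs_self K)
      have hI : 0 ≤ ∫ x in Ioi s, (Ξ x ^ m)⁻¹ :=
        setIntegral_nonneg measurableSet_Ioi fun x hx => by
          have := hΞpos x (hs0.trans (le_of_lt hx))
          positivity
      rw [hΛs, div_pow] at h4
      have h5 : (lam ^ m)⁻¹ * (∫ x in Ioi s, (Ξ x ^ m)⁻¹) ≤ |K| * Θ s := by
        have h6 : (1 : ℝ) ≤ N ^ m := one_le_pow₀ hN1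
        have h7 : N ^ m / lam ^ m * (Θ s)⁻¹ * (∫ x in Ioi s, (Ξ x ^ m)⁻¹) * Θ s =
            N ^ m * ((lam ^ m)⁻¹ * (∫ x in Ioi s, (Ξ x ^ m)⁻¹)) := by
          field_simp
        have h8 := mul_le_mul_of_nonneg_right h4 hΘs.le
        rw [h7] at h8
        refine le_trans (le_mul_of_one_le_left (by positivity) h6) h8
      calc _ ≤ lam * (|K| * Θ s) := by gcongr
        _ = _ := by ring
    calc _ ≤ _ := h1
      _ ≤ B₁ * (D * (w 0 ^ 2 + a 0 ^ 2 * lam ^ 2 * v 0 ^ 2) * Real.exp (P * (lam * Θ s))) *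
          Real.exp (B₁ * (|K| * (lam * Θ s))) := by gcongr
      _ = B₁ * D * (w 0 ^ 2 + a 0 ^ 2 * lam ^ 2 * v 0 ^ 2) *
          Real.exp ((P + B₁ * |K|) * (lam * Θ s)) := by
        rw [show (P + B₁ * |K|) * (lam * Θ s) =
          P * (lam * Θ s) + B₁ * (|K| * (lam * Θ s)) by ring, Real.exp_add]
        ring
      _ ≤ (max 1 B₁ * D) * (w 0 ^ 2 + a 0 ^ 2 * lam ^ 2 * v 0 ^ 2) *
          Real.exp (2 * lam * Θ (halfLineInv Λ (Q * N / lam))) := by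
        gcongr
        exact le_max_right _ _
      _ = _ := by ring

end SemiDiscreteWave

namespace SemiDiscreteWave

/-! ### The discrete-time Fourier transform -/

variable {d : ℕ}

/-- The character `θ ↦ e^{-i k·θ}`. -/
noncomputable def latticeChar (k : Lattice d) (θ : Fin d → ℝ) : ℂ :=
  Complex.exp (-Complex.I * ∑ i, ((k i : ℂ) * (θ i : ℂ)))

/-- The frequency box `[-π, π]^d`. -/
def freqBox (d : ℕ) : Set (Fin d → ℝ) := Icc (fun _ => -Real.pi) (fun _ => Real.pi)

theorem latticeChar_eq (k : Lattice d) (θ : Fin d → ℝ) :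
    latticeChar k θ = Complex.exp (Complex.I * ((-∑ i, (k i : ℝ) * θ i : ℝ) : ℂ)) := by
  rw [latticeChar]
  congr 1
  push_cast
  ring

theorem norm_latticeChar (k : Lattice d) (θ : Fin d → ℝ) : ‖latticeChar k θ‖ = 1 := by
  rw [latticeChar_eq, Complex.norm_exp_I_mul_ofReal]

theorem latticeChar_add (k l : Lattice d) (θ : Fin d → ℝ) :
    latticeChar (k + l) θ = latticeChar k θ * latticeChar l θ := by
  simp only [latticeChar]
  rw [← Complex.exp_add, ← mul_add, ← Finset.sum_add_distrib]
  congr 2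
  refine Finset.sum_congr rfl fun i _ => ?_
  simp only [Pi.add_apply]
  push_cast
  ring

theorem latticeChar_single (j : Fin d) (n : ℤ) (θ : Fin d → ℝ) :
    latticeChar (Pi.single j n) θ = Complex.exp (-Complex.I * (n * θ j)) := by
  rw [latticeChar, Finset.sum_eq_single j]
  · simp
  · intro i _ hi
    simp [hi]
  · simp

theorem continuous_latticeChar (k : Lattice d) : Continuous (latticeChar k) := by
  unfold latticeChar
  fun_prop

theorem dtft_eq (f : Lattice d → ℂ) (θ : Fin d → ℝ) : dtft f θ = ∑' k, latticeChar k θ * f k :=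
  rfl

theorem norm_latticeChar_mul (f : Lattice d → ℂ) (θ : Fin d → ℝ) (k : Lattice d) :
    ‖latticeChar k θ * f k‖ = ‖f k‖ := by
  rw [norm_mul, norm_latticeChar, one_mul]

theorem summable_latticeChar_mul {f : Lattice d → ℂ} (hf : Summable fun k => ‖f k‖)
    (θ : Fin d → ℝ) : Summable fun k => latticeChar k θ * f k :=
  Summable.of_norm (by simpa only [norm_latticeChar_mul] using hf)

theorem continuous_dtft {f : Lattice d → ℂ} (hf : Summable fun k => ‖f k‖) :
    Continuous (dtft f) :=
  continuous_tsum (fun k => (continuous_latticeChar k).mul continuous_const) hf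
    fun k θ => (norm_latticeChar_mul f θ k).le

theorem norm_dtft_le {f : Lattice d → ℂ} (hf : Summable fun k => ‖f k‖) (θ : Fin d → ℝ) :
    ‖dtft f θ‖ ≤ ∑' k, ‖f k‖ := by
  rw [dtft_eq]
  refine (norm_tsum_le_tsum_norm ?_).trans_eq ?_ <;> simp only [norm_latticeChar_mul, hf]

theorem dtft_sub {f g : Lattice d → ℂ} (hf : Summable fun k => ‖f k‖)
    (hg : Summable fun k => ‖g k‖) (θ : Fin d → ℝ) :
    dtft (fun k => f k - g k) θ = dtft f θ - dtft g θ := by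
  rw [dtft_eq, dtft_eq, dtft_eq,
    ← (summable_latticeChar_mul hf θ).tsum_sub (summable_latticeChar_mul hg θ)]
  simp only [mul_sub]

theorem summable_norm_shift {f : Lattice d → ℂ} (hf : Summable fun k => ‖f k‖) (l : Lattice d) :
    Summable fun k => ‖f (k + l)‖ :=
  hf.comp_injective (Equiv.addRight l).injective

theorem dtft_shift (f : Lattice d → ℂ) (l : Lattice d) (θ : Fin d → ℝ) :
    dtft (fun k => f (k + l)) θ = latticeChar (-l) θ * dtft f θ := by
  rw [dtft_eq, dtft_eq, ← tsum_mul_left, ← (Equiv.addRight (-l)).tsum_eq]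
  refine tsum_congr fun k => ?_
  simp only [Equiv.coe_addRight, neg_add_cancel_right, latticeChar_add]
  ring

theorem summable_norm_fwdDiff {f : Lattice d → ℂ} (hf : Summable fun k => ‖f k‖) (j : Fin d) :
    Summable fun k => ‖fwdDiff j f k‖ :=
  .of_nonneg_of_le (fun _ => norm_nonneg _) (fun _ => norm_sub_le _ _)
    ((summable_norm_shift hf _).add hf)

theorem summable_norm_bwdDiff {f : Lattice d → ℂ} (hf : Summable fun k => ‖f k‖) (j : Fin d) :
    Summable fun k => ‖bwdDiff j f k‖ := by
  have := summable_norm_shift hf (-Pi.single j 1)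
  simp only [← sub_eq_add_neg] at this
  exact .of_nonneg_of_le (fun _ => norm_nonneg _) (fun _ => norm_sub_le _ _) (hf.add this)

theorem dtft_fwdDiff {f : Lattice d → ℂ} (hf : Summable fun k => ‖f k‖) (j : Fin d)
    (θ : Fin d → ℝ) :
    dtft (fwdDiff j f) θ = (Complex.exp (Complex.I * θ j) - 1) * dtft f θ := by
  have := dtft_sub (summable_norm_shift hf (Pi.single j 1)) hf θ
  rw [dtft_shift, ← Pi.single_neg, latticeChar_single] at this
  rw [show fwdDiff j f = fun k => f (k + Pi.single j 1) - f k from rfl, this]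
  push_cast
  rw [sub_mul, one_mul]
  congr 3
  ring

theorem dtft_bwdDiff {f : Lattice d → ℂ} (hf : Summable fun k => ‖f k‖) (j : Fin d)
    (θ : Fin d → ℝ) :
    dtft (bwdDiff j f) θ = (1 - Complex.exp (-(Complex.I * θ j))) * dtft f θ := by
  have := dtft_sub hf (summable_norm_shift hf (-Pi.single j 1)) θ
  rw [dtft_shift, neg_neg, latticeChar_single] at this
  simp only [← sub_eq_add_neg] at this
  rw [show bwdDiff j f = fun k => f k - f (k - Pi.single j 1) from rfl, this]
  push_cast
  simp only [one_mul, neg_mul, sub_mul]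

theorem xiNorm_nonneg (θ : Fin d → ℝ) : 0 ≤ xiNorm θ := Real.sqrt_nonneg _

theorem xiNorm_sq (θ : Fin d → ℝ) : xiNorm θ ^ 2 = ∑ i, (2 * Real.sin (θ i / 2)) ^ 2 :=
  Real.sq_sqrt (Finset.sum_nonneg fun _ _ => sq_nonneg _)

theorem xiNorm_le (θ : Fin d → ℝ) : xiNorm θ ≤ 2 * Real.sqrt d := by
  rw [xiNorm, Real.sqrt_le_left (by positivity), mul_pow, Real.sq_sqrt (by positivity)]
  calc ∑ i, (2 * Real.sin (θ i / 2)) ^ 2 ≤ ∑ _i : Fin d, (4 : ℝ) := by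
        refine Finset.sum_le_sum fun i _ => ?_
        nlinarith [Real.sin_sq_le_one (θ i / 2)]
    _ = _ := by simp; ring

theorem dtft_discreteLaplacian {f : Lattice d → ℂ} (hf : Summable fun k => ‖f k‖)
    (θ : Fin d → ℝ) : dtft (discreteLaplacian f) θ = -(xiNorm θ : ℂ) ^ 2 * dtft f θ := by
  have h1 : dtft (discreteLaplacian f) θ = ∑ j, dtft (fwdDiff j (bwdDiff j f)) θ := by
    simp only [dtft_eq]
    rw [← Summable.tsum_finsetSum fun j _ => summable_latticeChar_mul
      (summable_norm_fwdDiff (summable_norm_bwdDiff hf j) j) θ]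
    simp only [discreteLaplacian, Finset.mul_sum]
  have h2 : ((xiNorm θ : ℂ)) ^ 2 = ∑ i, (((2 * Real.sin (θ i / 2)) ^ 2 : ℝ) : ℂ) := by
    rw [← Complex.ofReal_pow, xiNorm_sq]
    push_cast
    rfl
  rw [h1, h2, ← Finset.sum_neg_distrib, Finset.sum_mul]
  refine Finset.sum_congr rfl fun j _ => ?_
  rw [dtft_fwdDiff (summable_norm_bwdDiff hf j), dtft_bwdDiff hf, ← mul_assoc]
  congr 1
  have e1 : Complex.exp (Complex.I * θ j) * Complex.exp (-(Complex.I * θ j)) = 1 := by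
    rw [← Complex.exp_add]; simp
  have e2 : Complex.exp (Complex.I * θ j) + Complex.exp (-(Complex.I * θ j)) =
      2 * Complex.cos (θ j) := by
    rw [Complex.cos]
    rw [mul_comm Complex.I, neg_mul]
    ring
  have e3 : (2 * Real.sin (θ j / 2)) ^ 2 = 2 - 2 * Real.cos (θ j) := by
    have : θ j = 2 * (θ j / 2) := by ring
    conv_rhs => rw [this, Real.cos_two_mul]
    nlinarith [Real.sin_sq_add_cos_sq (θ j / 2)]
  rw [e3]
  push_cast
  linear_combination e2 - e1

theorem sum_norm_dtft_fwdDiff_sq {f : Lattice d → ℂ} (hf : Summable fun k => ‖f k‖)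
    (θ : Fin d → ℝ) :
    ∑ j, ‖dtft (fwdDiff j f) θ‖ ^ 2 = xiNorm θ ^ 2 * ‖dtft f θ‖ ^ 2 := by
  rw [xiNorm_sq, Finset.sum_mul]
  refine Finset.sum_congr rfl fun j _ => ?_
  rw [dtft_fwdDiff hf, norm_mul, Complex.norm_exp_I_mul_ofReal_sub_one, mul_pow, Real.norm_eq_abs,
    sq_abs]

/-! ### Plancherel's identity for absolutely summable sequences -/

theorem integral_exp_int_mul (n : ℤ) :
    ∫ x in Icc (-Real.pi) Real.pi, Complex.exp (-Complex.I * (n * x)) =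
      if n = 0 then (2 * Real.pi : ℂ) else 0 := by
  rw [integral_Icc_eq_integral_Ioc,
    ← intervalIntegral.integral_of_le (by linarith [Real.pi_pos])]
  split_ifs with h
  · subst h
    simp
    ring
  · have hc : -Complex.I * n ≠ 0 := by simp [h]
    simp only [← mul_assoc]
    rw [integral_exp_mul_complex hc]
    rw [div_eq_zero_iff]
    left
    rw [sub_eq_zero, Complex.exp_eq_exp_iff_exists_int]
    refine ⟨-n, ?_⟩
    push_cast
    ring

instance : IsFiniteMeasure (volume.restrict (freqBox d)) :=
  ⟨by
    rw [Measure.restrict_apply_univ]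
    exact isCompact_Icc.measure_lt_top⟩

theorem integral_latticeChar (k : Lattice d) :
    ∫ θ in freqBox d, latticeChar k θ = if k = 0 then (2 * Real.pi : ℂ) ^ d else 0 := by
  have h1 : ∀ θ : Fin d → ℝ, latticeChar k θ =
      ∏ i, Complex.exp (-Complex.I * ((k i : ℂ) * (θ i : ℂ))) := fun θ => by
    rw [latticeChar, Finset.mul_sum, Complex.exp_sum]
  simp only [h1]
  rw [freqBox, ← pi_univ_Icc, volume_pi, Measure.restrict_pi_pi,
    integral_fintype_prod_eq_prod (fun i (x : ℝ) => Complex.exp (-Complex.I * ((k i : ℂ) * (x : ℂ))))]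
  simp only [integral_exp_int_mul]
  split_ifs with h
  · subst h
    simp
  · obtain ⟨i, hi⟩ := Function.ne_iff.1 h
    exact Finset.prod_eq_zero (Finset.mem_univ i) (if_neg hi)

theorem conj_latticeChar (k : Lattice d) (θ : Fin d → ℝ) :
    (starRingEnd ℂ) (latticeChar k θ) = latticeChar (-k) θ := by
  rw [latticeChar_eq, latticeChar_eq, ← Complex.exp_conj]
  congr 1
  simp

theorem integral_dtft_mul {f : Lattice d → ℂ} (hf : Summable fun k => ‖f k‖) (k : Lattice d) :
    ∫ θ in freqBox d, dtft f θ * latticeChar (-k) θ = (2 * Real.pi : ℂ) ^ d * f k := by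
  have h1 : ∀ l : Lattice d, Integrable (fun θ => latticeChar l θ * f l * latticeChar (-k) θ)
      (volume.restrict (freqBox d)) := fun l => by
    refine Integrable.of_bound (C := ‖f l‖) ?_ (.of_forall fun θ => ?_)
    · exact (((continuous_latticeChar l).mul continuous_const).mul
        (continuous_latticeChar (-k))).aestronglyMeasurable
    · rw [norm_mul, norm_latticeChar, mul_one, norm_latticeChar_mul]
  have h2 := hasSum_integral_of_summable_integral_norm h1 ?_
  · simp only [tsum_mul_right] at h2
    have h3 : ∀ l : Lattice d, ∫ θ in freqBox d, latticeChar l θ * f l * latticeChar (-k) θ =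
        if l = k then (2 * Real.pi : ℂ) ^ d * f k else 0 := by
      intro l
      have : ∀ θ : Fin d → ℝ, latticeChar l θ * f l * latticeChar (-k) θ =
          latticeChar (l + -k) θ * f l := fun θ => by rw [latticeChar_add]; ring
      simp only [this]
      rw [integral_mul_const, integral_latticeChar]
      simp only [← sub_eq_add_neg, sub_eq_zero]
      split_ifs with h
      · rw [h]
      · simp
    simp only [h3] at h2
    exact h2.unique (hasSum_ite_eq k _)
  · have : ∀ l : Lattice d, ∫ θ in freqBox d, ‖latticeChar l θ * f l * latticeChar (-k) θ‖ =
        (volume.restrict (freqBox d)).real univ * ‖f l‖ := fun l => by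
      simp [norm_latticeChar]
    simp only [this]
    exact hf.mul_left _

/-- One factor of `f̂ · conj f̂` is expanded in its series and integrated termwise; each term is a
Fourier coefficient given by `integral_dtft_mul`. Absolute summability dominates the interchange. -/
theorem hasSum_norm_sq {f : Lattice d → ℂ} (hf : Summable fun k => ‖f k‖) :
    HasSum (fun k => (2 * Real.pi) ^ d * ‖f k‖ ^ 2) (∫ θ in freqBox d, ‖dtft f θ‖ ^ 2) := by
  have hc := continuous_dtft hf
  have h1 : ∀ k : Lattice d, Integrable
      (fun θ => dtft f θ * latticeChar (-k) θ * (starRingEnd ℂ) (f k))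
      (volume.restrict (freqBox d)) := fun k => by
    refine Integrable.of_bound (C := (∑' k, ‖f k‖) * ‖f k‖) ?_ (.of_forall fun θ => ?_)
    · exact ((hc.mul (continuous_latticeChar (-k))).mul continuous_const).aestronglyMeasurable
    · rw [norm_mul, norm_mul, norm_latticeChar, mul_one, RCLike.norm_conj]
      exact mul_le_mul_of_nonneg_right (norm_dtft_le hf θ) (norm_nonneg _)
  have h2 := hasSum_integral_of_summable_integral_norm h1 ?_
  · have h3 : ∀ θ : Fin d → ℝ,
        ∑' k, dtft f θ * latticeChar (-k) θ * (starRingEnd ℂ) (f k) = ((‖dtft f θ‖ ^ 2 : ℝ) : ℂ) := by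
      intro θ
      have : ∀ k : Lattice d, dtft f θ * latticeChar (-k) θ * (starRingEnd ℂ) (f k) =
          dtft f θ * (starRingEnd ℂ) (latticeChar k θ * f k) := fun k => by
        rw [map_mul, conj_latticeChar, mul_assoc]
      simp only [this]
      rw [tsum_mul_left, ← Complex.conj_tsum, ← dtft_eq, Complex.mul_conj, Complex.normSq_eq_norm_sq]
    simp only [h3, integral_mul_const, integral_dtft_mul hf] at h2
    rw [integral_complex_ofReal] at h2
    have h4 : ∀ k, (2 * Real.pi : ℂ) ^ d * f k * (starRingEnd ℂ) (f k) =
        (((2 * Real.pi) ^ d * ‖f k‖ ^ 2 : ℝ) : ℂ) := fun k => by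
      rw [mul_assoc, Complex.mul_conj, Complex.normSq_eq_norm_sq]
      push_cast
      rfl
    simp only [h4] at h2
    exact Complex.hasSum_ofReal.1 h2
  · refine Summable.of_nonneg_of_le (fun _ => integral_nonneg fun _ => norm_nonneg _) (fun k => ?_)
      (hf.mul_left ((volume.restrict (freqBox d)).real univ * ∑' k, ‖f k‖))
    have : ∫ θ in freqBox d, ‖dtft f θ * latticeChar (-k) θ * (starRingEnd ℂ) (f k)‖ ≤
        ∫ _θ in freqBox d, (∑' k, ‖f k‖) * ‖f k‖ := by
      refine integral_mono (h1 k).norm (integrable_const _) fun θ => ?_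
      simp only [norm_mul, norm_latticeChar, mul_one, RCLike.norm_conj]
      exact mul_le_mul_of_nonneg_right (norm_dtft_le hf θ) (norm_nonneg _)
    refine this.trans (le_of_eq ?_)
    simp
    ring

theorem lintegral_norm_dtft_sq {f : Lattice d → ℂ} (hf : Summable fun k => ‖f k‖) :
    ∫⁻ θ in freqBox d, ENNReal.ofReal (‖dtft f θ‖ ^ 2) =
      ENNReal.ofReal ((2 * Real.pi) ^ d) * ∑' k, ‖f k‖ₑ ^ 2 := by
  have h := hasSum_norm_sq hf
  have hc := continuous_dtft hf
  rw [← ofReal_integral_eq_lintegral_ofReal, ← h.tsum_eq, ENNReal.ofReal_tsum_of_nonneg,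
    ← ENNReal.tsum_mul_left]
  · refine tsum_congr fun k => ?_
    rw [ENNReal.ofReal_mul (by positivity), ENNReal.ofReal_pow (norm_nonneg _), ofReal_norm]
  · intro k
    positivity
  · exact h.summable
  · refine Integrable.of_bound (C := (∑' k, ‖f k‖) ^ 2)
      (hc.norm.pow 2).aestronglyMeasurable (.of_forall fun θ => ?_)
    rw [norm_pow, norm_norm]
    exact pow_le_pow_left₀ (norm_nonneg _) (norm_dtft_le hf θ) 2
  · exact .of_forall fun θ => by positivity

/-- The energy in frequency space. -/
theorem energy_eq_lintegral {f g : Lattice d → ℂ} (hf : Summable fun k => ‖f k‖)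
    (hg : Summable fun k => ‖g k‖) (c : ℝ) :
    ENNReal.ofReal ((2 * Real.pi) ^ d) * energy c f g =
      ∫⁻ θ in freqBox d, ENNReal.ofReal (energyDensity c f g θ) := by
  have hfc := continuous_dtft hf
  have hgc := continuous_dtft hg
  have h1 : ∀ θ, ENNReal.ofReal (energyDensity c f g θ) = ENNReal.ofReal (‖dtft g θ‖ ^ 2) +
      ENNReal.ofReal (c ^ 2) * ∑ j, ENNReal.ofReal (‖dtft (fwdDiff j f) θ‖ ^ 2) := by
    intro θ
    rw [energyDensity, mul_assoc, ← sum_norm_dtft_fwdDiff_sq hf, ENNReal.ofReal_add (by positivity)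
      (by positivity), ENNReal.ofReal_mul (by positivity), ENNReal.ofReal_sum_of_nonneg]
    intro j _
    positivity
  have hm : ∀ j, Measurable fun θ => ENNReal.ofReal (‖dtft (fwdDiff j f) θ‖ ^ 2) := fun j =>
    ((continuous_dtft (summable_norm_fwdDiff hf j)).norm.pow 2).measurable.ennreal_ofReal
  have hmg : Measurable fun θ => ENNReal.ofReal (‖dtft g θ‖ ^ 2) :=
    (hgc.norm.pow 2).measurable.ennreal_ofReal
  simp only [h1]
  rw [lintegral_add_left hmg,
    lintegral_const_mul _ (Finset.measurable_sum _ fun j _ => hm j),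
    lintegral_finsetSum _ fun j _ => hm j, lintegral_norm_dtft_sq hg]
  simp only [lintegral_norm_dtft_sq (summable_norm_fwdDiff hf _)]
  rw [energy, ← Finset.mul_sum]
  ring

end SemiDiscreteWave

namespace SemiDiscreteWave

/-! ### Weighted bounds for solutions -/

variable {d : ℕ}

/-- Translation of a real square summable sequence. -/
noncomputable def shiftSq (l : Lattice d) (f : lp (fun _ : Lattice d => ℝ) 2) :
    lp (fun _ : Lattice d => ℝ) 2 :=
  ⟨fun k => f (k + l), by
    have h := (lp.memℓp f).summable (by simp)
    exact (memℓp_gen_iff (by simp)).2 (h.comp_injective (Equiv.addRight l).injective)⟩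

theorem shiftSq_apply (l : Lattice d) (f : lp (fun _ : Lattice d => ℝ) 2) (k : Lattice d) :
    shiftSq l f k = f (k + l) := rfl

theorem norm_shiftSq (l : Lattice d) (f : lp (fun _ : Lattice d => ℝ) 2) :
    ‖shiftSq l f‖ = ‖f‖ := by
  rw [lp.norm_eq_tsum_rpow (by simp), lp.norm_eq_tsum_rpow (by simp)]
  congr 1
  exact (Equiv.addRight l).tsum_eq fun k => ‖f k‖ ^ (2 : ℝ≥0∞).toReal

theorem memℓp_weight_mul {W : Lattice d → ℝ} {R : ℝ} (hW : ∀ k, |W k| ≤ R) (f : SqSummable d) :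
    Memℓp (fun k => (W k : ℂ) * f k) 2 := by
  refine ((lp.memℓp f).const_smul R).mono' fun k => ?_
  simp only [Pi.smul_apply, norm_smul, norm_mul, Complex.norm_real]
  exact mul_le_mul_of_nonneg_right ((hW k).trans (le_abs_self R)) (norm_nonneg _)

/-- Multiplication by a bounded weight on `ℓ²`. -/
noncomputable def weightMul (W : Lattice d → ℝ) {R : ℝ} (hW : ∀ k, |W k| ≤ R) :
    SqSummable d →L[ℝ] SqSummable d :=
  LinearMap.mkContinuous
    { toFun := fun f => ⟨fun k => (W k : ℂ) * f k, memℓp_weight_mul hW f⟩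
      map_add' := fun f g => by
        ext k
        exact mul_add _ _ _
      map_smul' := fun c f => by
        ext k
        simp
        ring } |R| fun f => by
    have : ‖|R| • f‖ = |R| * ‖f‖ := by rw [norm_smul, Real.norm_eq_abs, abs_abs]
    rw [← this]
    refine lp.norm_mono (by simp) fun k => ?_
    simp only [LinearMap.coe_mk, AddHom.coe_mk, lp.coeFn_smul, Pi.smul_apply, norm_smul, norm_mul,
      Complex.norm_real, Real.norm_eq_abs, abs_abs]
    exact mul_le_mul_of_nonneg_right ((hW k).trans (le_abs_self R)) (norm_nonneg _)

theorem weightMul_apply {W : Lattice d → ℝ} {R : ℝ} (hW : ∀ k, |W k| ≤ R) (f : SqSummable d)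
    (k : Lattice d) : weightMul W hW f k = (W k : ℂ) * f k := rfl

theorem norm_discreteLaplacian_le (f : Lattice d → ℂ) (k : Lattice d) :
    ‖discreteLaplacian f k‖ ≤
      ∑ j, (‖f (k + Pi.single j 1)‖ + 2 * ‖f k‖ + ‖f (k - Pi.single j 1)‖) := by
  refine norm_sum_le_of_le _ fun j _ => ?_
  simp only [fwdDiff, bwdDiff, add_sub_cancel_right]
  calc _ ≤ ‖f (k + Pi.single j 1) - f k‖ + ‖f k - f (k - Pi.single j 1)‖ := norm_sub_le _ _
    _ ≤ (‖f (k + Pi.single j 1)‖ + ‖f k‖) + (‖f k‖ + ‖f (k - Pi.single j 1)‖) :=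
      add_le_add (norm_sub_le _ _) (norm_sub_le _ _)
    _ = _ := by ring

/-- A weight that varies by at most a factor `c` between neighbours passes through unit shifts at
cost `c`. The resulting constant does not involve the bound `R` on the weight, which is what permits
truncated weights later. -/
theorem norm_weightMul_le {W : Lattice d → ℝ} {R c b : ℝ} (hW : ∀ k, |W k| ≤ R)
    (hW0 : ∀ k, 0 ≤ W k) (hc : 0 ≤ c) (h1 : ∀ j k, W k ≤ c * W (k + Pi.single j 1))
    (h2 : ∀ j k, W k ≤ c * W (k - Pi.single j 1)) (hb : 0 ≤ b) {f g : SqSummable d}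
    (hg : ∀ k, ‖g k‖ ≤ b * ‖discreteLaplacian f k‖) :
    ‖weightMul W hW g‖ ≤ b * (d * (2 * c + 2)) * ‖weightMul W hW f‖ := by
  set N : lp (fun _ : Lattice d => ℝ) 2 :=
    ⟨fun k => ‖weightMul W hW f k‖, (lp.memℓp (weightMul W hW f)).norm⟩ with hN
  have hNk : ∀ k, N k = W k * ‖f k‖ := fun k => by
    simp [hN, weightMul_apply, abs_of_nonneg (hW0 k)]
  have hNn : ‖N‖ ≤ ‖weightMul W hW f‖ := lp.norm_mono (by simp) fun k => by
    simp [hN]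
  set Y : lp (fun _ : Lattice d => ℝ) 2 := b • ∑ j : Fin d,
    (c • shiftSq (Pi.single j 1) N + (2 : ℝ) • N + c • shiftSq (-Pi.single j 1) N) with hY
  have hYn : ‖Y‖ ≤ b * (d * (2 * c + 2)) * ‖N‖ := by
    rw [hY, norm_smul, Real.norm_of_nonneg hb, mul_assoc]
    refine mul_le_mul_of_nonneg_left ?_ hb
    refine (norm_sum_le_of_le _ (f := fun j : Fin d => c • shiftSq (Pi.single j 1) N +
      (2 : ℝ) • N + c • shiftSq (-Pi.single j 1) N) (n := fun _ => (2 * c + 2) * ‖N‖)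
      fun j _ => ?_).trans (le_of_eq ?_)
    · refine (norm_add₃_le).trans (le_of_eq ?_)
      rw [norm_smul, norm_smul, norm_smul, norm_shiftSq, norm_shiftSq, Real.norm_of_nonneg hc,
        Real.norm_of_nonneg zero_le_two]
      ring
    · simp
      ring
  have hgY : ‖weightMul W hW g‖ ≤ ‖Y‖ := by
    refine lp.norm_mono (by simp) fun k => ?_
    have e : Y k = b * ∑ j : Fin d, (c * (W (k + Pi.single j 1) * ‖f (k + Pi.single j 1)‖) +
        2 * (W k * ‖f k‖) + c * (W (k - Pi.single j 1) * ‖f (k - Pi.single j 1)‖)) := by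
      simp only [hY, lp.coeFn_smul, Pi.smul_apply, lp.coeFn_sum, Finset.sum_apply, lp.coeFn_add,
        Pi.add_apply, shiftSq_apply, hNk, smul_eq_mul, sub_eq_add_neg]
    rw [e, weightMul_apply, norm_mul, Complex.norm_real, Real.norm_of_nonneg (hW0 k)]
    refine le_trans ?_ (Real.le_norm_self _)
    calc W k * ‖g k‖ ≤ W k * (b * ∑ j, (‖f (k + Pi.single j 1)‖ + 2 * ‖f k‖ +
          ‖f (k - Pi.single j 1)‖)) := by
          refine mul_le_mul_of_nonneg_left ((hg k).trans ?_) (hW0 k)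
          exact mul_le_mul_of_nonneg_left (norm_discreteLaplacian_le _ _) hb
      _ = b * ∑ j, (W k * ‖f (k + Pi.single j 1)‖ + 2 * (W k * ‖f k‖) +
          W k * ‖f (k - Pi.single j 1)‖) := by
        rw [mul_left_comm, Finset.mul_sum]
        congr 1
        refine Finset.sum_congr rfl fun j _ => ?_
        ring
      _ ≤ _ := by
        refine mul_le_mul_of_nonneg_left (Finset.sum_le_sum fun j _ => ?_) hb
        refine add_le_add (add_le_add ?_ le_rfl) ?_
        · rw [← mul_assoc]
          exact mul_le_mul_of_nonneg_right (h1 j k) (norm_nonneg _)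
        · rw [← mul_assoc]
          exact mul_le_mul_of_nonneg_right (h2 j k) (norm_nonneg _)
  exact hgY.trans (hYn.trans (mul_le_mul_of_nonneg_left hNn (by positivity)))

variable {a : ℝ → ℝ} {u₀ u₁ : SqSummable d} {u v : ℝ → SqSummable d}

/-- Gronwall's inequality for the first-order system satisfied by the weighted pair `(u, v)`, in the
maximum norm; again `R` does not enter the rate. -/
theorem IsSolution.norm_weightMul_le (h : IsSolution a u₀ u₁ u v) {a₁ : ℝ}
    (ha : ∀ t, 0 ≤ t → |a t| ≤ a₁) {W : Lattice d → ℝ} {R c : ℝ} (hW : ∀ k, |W k| ≤ R)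
    (hW0 : ∀ k, 0 ≤ W k) (hc : 0 ≤ c) (h1 : ∀ j k, W k ≤ c * W (k + Pi.single j 1))
    (h2 : ∀ j k, W k ≤ c * W (k - Pi.single j 1)) {t : ℝ} (ht : 0 ≤ t) :
    ‖(weightMul W hW (u t), weightMul W hW (v t))‖ ≤
      ‖(weightMul W hW u₀, weightMul W hW u₁)‖ *
        Real.exp (max 1 (a₁ ^ 2 * (d * (2 * c + 2))) * t) := by
  have hv : ∀ t, ∃ w : SqSummable d, 0 ≤ t → HasDerivWithinAt v w (Ici 0) t ∧
      ∀ k, w k = (a t : ℂ) ^ 2 * discreteLaplacian (u t) k := fun t => by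
    by_cases ht : 0 ≤ t
    · obtain ⟨w, hw⟩ := h.deriv_vel t ht
      exact ⟨w, fun _ => hw⟩
    · exact ⟨0, fun h => absurd h ht⟩
  choose w hw using hv
  have hd : ∀ s, 0 ≤ s → HasDerivWithinAt
      (fun t => (weightMul W hW (u t), weightMul W hW (v t)))
      (weightMul W hW (v s), weightMul W hW (w s)) (Ici 0) s := fun s hs =>
    ((weightMul W hW).hasFDerivAt.comp_hasDerivWithinAt s (h.deriv_pos s hs)).prodMk
      ((weightMul W hW).hasFDerivAt.comp_hasDerivWithinAt s (hw s hs).1)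
  have := norm_le_gronwallBound_of_norm_deriv_right_le (a := 0) (b := t) (ε := 0)
    (K := max 1 (a₁ ^ 2 * (d * (2 * c + 2))))
    (δ := ‖(weightMul W hW u₀, weightMul W hW u₁)‖)
    (f := fun t => (weightMul W hW (u t), weightMul W hW (v t)))
    (fun s hs => ((hd s hs.1).continuousWithinAt).mono fun x hx => hx.1)
    (fun s hs => (hd s hs.1).mono (Ici_subset_Ici.2 hs.1)) ?_ ?_ t ⟨ht, le_rfl⟩
  · rwa [gronwallBound_ε0, sub_zero] at this
  · rw [h.init_pos, h.init_vel]
  · intro s hs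
    rw [add_zero, Prod.norm_def]
    have e1 : ‖weightMul W hW (w s)‖ ≤ a₁ ^ 2 * (d * (2 * c + 2)) * ‖weightMul W hW (u s)‖ := by
      refine SemiDiscreteWave.norm_weightMul_le hW hW0 hc h1 h2 (by positivity) fun k => ?_
      rw [(hw s hs.1).2 k, norm_mul, norm_pow, Complex.norm_real]
      gcongr
      exact ha s hs.1
    refine max_le ?_ ?_
    · calc ‖weightMul W hW (v s)‖ ≤ 1 * ‖(weightMul W hW (u s), weightMul W hW (v s))‖ := by
            rw [one_mul]
            exact le_max_right _ _
        _ ≤ _ := mul_le_mul_of_nonneg_right (le_max_left _ _) (norm_nonneg _)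
    · refine e1.trans ?_
      gcongr
      · exact le_max_right _ _
      · exact le_max_left _ _

/-- An unbounded `ω` need not act on `ℓ²`. For each fixed `k` the truncation `min (ω l) (ω k)` is
bounded, inherits the constant `c` because `c ≥ 1`, and equals `ω k` at `l = k`; the resulting
estimate is uniform in `k`. -/
theorem IsSolution.pointwise_le (h : IsSolution a u₀ u₁ u v) {a₁ : ℝ}
    (ha : ∀ t, 0 ≤ t → |a t| ≤ a₁) {ω : Lattice d → ℝ} {c : ℝ}
    (hω0 : ∀ k, 0 ≤ ω k) (hc : 1 ≤ c) (h1 : ∀ j k, ω k ≤ c * ω (k + Pi.single j 1))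
    (h2 : ∀ j k, ω k ≤ c * ω (k - Pi.single j 1)) (F₀ F₁ : SqSummable d)
    (hF₀ : ∀ k, ω k * ‖u₀ k‖ ≤ ‖F₀ k‖) (hF₁ : ∀ k, ω k * ‖u₁ k‖ ≤ ‖F₁ k‖) (T : ℝ) :
    ∃ B : ℝ, 0 ≤ B ∧ ∀ t, 0 ≤ t → t ≤ T → ∀ k, ω k * ‖u t k‖ ≤ B ∧ ω k * ‖v t k‖ ≤ B := by
  set κ := max 1 (a₁ ^ 2 * (d * (2 * c + 2)))
  have hκ : 0 ≤ κ := zero_le_one.trans (le_max_left _ _)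
  refine ⟨‖(F₀, F₁)‖ * Real.exp (κ * T), by positivity, fun t ht htT k => ?_⟩
  have hW : ∀ l, |min (ω l) (ω k)| ≤ ω k := fun l => by
    rw [abs_of_nonneg (le_min (hω0 l) (hω0 k))]
    exact min_le_right _ _
  have hmin : ∀ x y : ℝ, 0 ≤ y → x ≤ c * y → min x (ω k) ≤ c * min y (ω k) := by
    intro x y hy hxy
    rw [mul_min_of_nonneg _ _ (by linarith : 0 ≤ c)]
    exact min_le_min hxy (le_mul_of_one_le_left (hω0 k) hc)
  have key := h.norm_weightMul_le ha hW (fun l => le_min (hω0 l) (hω0 k)) (by linarith)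
    (fun j l => hmin _ _ (hω0 _) (h1 j l)) (fun j l => hmin _ _ (hω0 _) (h2 j l)) ht
  have hle : ∀ (f F : SqSummable d), (∀ k, ω k * ‖f k‖ ≤ ‖F k‖) → ‖weightMul _ hW f‖ ≤ ‖F‖ := by
    intro f F hF
    refine lp.norm_mono (by simp) fun l => ?_
    rw [weightMul_apply, norm_mul, Complex.norm_real,
      Real.norm_of_nonneg (le_min (hω0 l) (hω0 k))]
    exact (mul_le_mul_of_nonneg_right (min_le_left _ _) (norm_nonneg _)).trans (hF l)
  have hdata : ‖(weightMul _ hW u₀, weightMul _ hW u₁)‖ ≤ ‖(F₀, F₁)‖ :=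
    max_le_max (hle _ _ hF₀) (hle _ _ hF₁)
  have hfin := key.trans (mul_le_mul hdata
    (Real.exp_le_exp.2 (mul_le_mul_of_nonneg_left htT hκ)) (Real.exp_pos _).le (norm_nonneg _))
  have hpt : ∀ f : SqSummable d, ω k * ‖f k‖ ≤ ‖weightMul _ hW f‖ := by
    intro f
    refine le_trans (le_of_eq ?_) (lp.norm_apply_le_norm (by simp) (weightMul _ hW f) k)
    rw [weightMul_apply, norm_mul, Complex.norm_real,
      Real.norm_of_nonneg (le_min (hω0 k) (hω0 k)), min_self]
  exact ⟨(hpt _).trans ((le_max_left _ _).trans hfin), (hpt _).trans ((le_max_right _ _).trans hfin)⟩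

/-! ### The solution in frequency space -/

theorem hasDerivAt_dtft {f g : ℝ → Lattice d → ℂ} {B : Lattice d → ℝ} {T : ℝ} (hB : Summable B)
    (hf : ∀ k, ∀ t ∈ Ioo 0 T, HasDerivAt (fun s => f s k) (g t k) t)
    (hfB : ∀ t ∈ Ioo 0 T, ∀ k, ‖f t k‖ ≤ B k) (hgB : ∀ t ∈ Ioo 0 T, ∀ k, ‖g t k‖ ≤ B k)
    (θ : Fin d → ℝ) {t : ℝ} (ht : t ∈ Ioo 0 T) :
    HasDerivAt (fun s => dtft (f s) θ) (dtft (g t) θ) t := by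
  refine hasDerivAt_tsum_of_isPreconnected hB isOpen_Ioo isPreconnected_Ioo
    (g := fun k s => latticeChar k θ * f s k) (g' := fun k s => latticeChar k θ * g s k)
    (fun k s hs => (hf k s hs).const_mul _) (fun k s hs => ?_) ht ?_ ht
  · rw [norm_latticeChar_mul]
    exact hgB s hs k
  · exact summable_latticeChar_mul (.of_nonneg_of_le (fun _ => norm_nonneg _) (hfB t ht) hB) θ

theorem continuousOn_dtft_curve {f : ℝ → Lattice d → ℂ}
    (hB : ∀ T : ℝ, ∃ B : Lattice d → ℝ, Summable B ∧ ∀ t ∈ Icc 0 T, ∀ k, ‖f t k‖ ≤ B k)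
    (hf : ∀ k, ContinuousOn (fun s => f s k) (Ici 0)) (θ : Fin d → ℝ) :
    ContinuousOn (fun s => dtft (f s) θ) (Ici 0) := by
  intro t ht
  obtain ⟨B, hB, hfB⟩ := hB (t + 1)
  have : ContinuousOn (fun s => dtft (f s) θ) (Icc 0 (t + 1)) := by
    refine continuousOn_tsum (u := B)
      (fun k => continuousOn_const.mul ((hf k).mono fun x hx => hx.1)) hB fun k s hs => ?_
    rw [norm_mul]
    rw [show ‖Complex.exp (-Complex.I * ∑ i, ((k i : ℂ) * (θ i : ℂ)))‖ = 1 from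
      norm_latticeChar k θ, one_mul]
    exact hfB s hs k
  refine (this t ⟨ht, by linarith⟩).mono_of_mem_nhdsWithin ?_
  have : Iic (t + 1) ∈ 𝓝 t := Iic_mem_nhds (by linarith)
  exact mem_of_superset (inter_mem_nhdsWithin _ this) fun x hx => ⟨hx.1, hx.2⟩

/-- Each frequency of a solution whose data have enough decay solves the mode equation. -/
theorem IsSolution.dtft_mode (h : IsSolution a u₀ u₁ u v) {a₁ : ℝ}
    (ha : ∀ t, 0 ≤ t → |a t| ≤ a₁) {ω : Lattice d → ℝ} {c : ℝ}
    (hω0 : ∀ k, 0 < ω k) (hω : Summable fun k => (ω k)⁻¹)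
    (hc : 1 ≤ c) (h1 : ∀ j k, ω k ≤ c * ω (k + Pi.single j 1))
    (h2 : ∀ j k, ω k ≤ c * ω (k - Pi.single j 1)) (F₀ F₁ : SqSummable d)
    (hF₀ : ∀ k, ω k * ‖u₀ k‖ ≤ ‖F₀ k‖) (hF₁ : ∀ k, ω k * ‖u₁ k‖ ≤ ‖F₁ k‖) :
    (∀ t, 0 ≤ t → (Summable fun k => ‖u t k‖) ∧ Summable fun k => ‖v t k‖) ∧
    ∀ θ, ContinuousOn (fun t => dtft (u t) θ) (Ici 0) ∧ ContinuousOn (fun t => dtft (v t) θ) (Ici 0) ∧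
      ∀ t, 0 < t → HasDerivAt (fun t => dtft (u t) θ) (dtft (v t) θ) t ∧
        HasDerivAt (fun t => dtft (v t) θ) (-((a t : ℂ) ^ 2 * (xiNorm θ : ℂ) ^ 2 * dtft (u t) θ)) t := by
  have hb := h.pointwise_le ha (fun k => (hω0 k).le) hc h1 h2 F₀ F₁ hF₀ hF₁
  -- One summable majorant, uniform on `[0, T]`, for `u`, `v` and `v'`: it justifies differentiating
  -- the Fourier series termwise.
  have hdom : ∀ T : ℝ, ∃ B : Lattice d → ℝ, Summable B ∧ ∀ t ∈ Icc 0 T, ∀ k,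
      ‖u t k‖ ≤ B k ∧ ‖v t k‖ ≤ B k ∧ ‖(a t : ℂ) ^ 2 * discreteLaplacian (u t) k‖ ≤ B k := by
    intro T
    obtain ⟨B, hB0, hB⟩ := hb T
    have hc0 : 0 ≤ a₁ ^ 2 * (d * (2 * c + 2)) := by positivity
    refine ⟨fun k => (1 + a₁ ^ 2 * (d * (2 * c + 2))) * (B * (ω k)⁻¹),
      (hω.mul_left B).mul_left _, fun t ht k => ?_⟩
    have hp : ∀ k, ‖u t k‖ ≤ B * (ω k)⁻¹ := fun k => by
      rw [← div_eq_mul_inv, le_div_iff₀ (hω0 k), mul_comm]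
      exact (hB t ht.1 ht.2 k).1
    have hq : ‖v t k‖ ≤ B * (ω k)⁻¹ := by
      rw [← div_eq_mul_inv, le_div_iff₀ (hω0 k), mul_comm]
      exact (hB t ht.1 ht.2 k).2
    have hBk : 0 ≤ B * (ω k)⁻¹ := by
      have := hω0 k
      positivity
    have hone : B * (ω k)⁻¹ ≤ (1 + a₁ ^ 2 * (d * (2 * c + 2))) * (B * (ω k)⁻¹) :=
      le_mul_of_one_le_left hBk (by linarith)
    have hinv : ∀ l, ω k ≤ c * ω l → B * (ω l)⁻¹ ≤ c * (B * (ω k)⁻¹) := by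
      intro l hl
      rw [mul_left_comm]
      refine mul_le_mul_of_nonneg_left ?_ hB0
      rw [← div_eq_mul_inv, le_div_iff₀ (hω0 k), inv_mul_le_iff₀ (hω0 l), mul_comm]
      exact hl
    refine ⟨(hp k).trans hone, hq.trans hone, ?_⟩
    rw [norm_mul, norm_pow, Complex.norm_real]
    calc ‖a t‖ ^ 2 * ‖discreteLaplacian (u t) k‖
        ≤ a₁ ^ 2 * ∑ _j : Fin d, (2 * c + 2) * (B * (ω k)⁻¹) := by
          refine mul_le_mul (pow_le_pow_left₀ (norm_nonneg _) (ha t ht.1) 2) ?_ (norm_nonneg _)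
            (by positivity)
          refine (norm_discreteLaplacian_le _ _).trans (Finset.sum_le_sum fun j _ => ?_)
          have e1 := (hp (k + Pi.single j 1)).trans (hinv _ (h1 j k))
          have e2 := (hp (k - Pi.single j 1)).trans (hinv _ (h2 j k))
          linarith [hp k]
      _ = a₁ ^ 2 * (d * (2 * c + 2)) * (B * (ω k)⁻¹) := by
        simp
        ring
      _ ≤ _ := by
        dsimp only
        rw [add_mul]
        linarith
  have hsum : ∀ t, 0 ≤ t → (Summable fun k => ‖u t k‖) ∧ Summable fun k => ‖v t k‖ := by
    intro t ht
    obtain ⟨B, hB, hB'⟩ := hdom t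
    exact ⟨.of_nonneg_of_le (fun _ => norm_nonneg _) (fun k => (hB' t ⟨ht, le_rfl⟩ k).1) hB,
      .of_nonneg_of_le (fun _ => norm_nonneg _) (fun k => (hB' t ⟨ht, le_rfl⟩ k).2.1) hB⟩
  have hud : ∀ k t, 0 ≤ t → HasDerivWithinAt (fun s => u s k) (v t k) (Ici 0) t := fun k t ht =>
    (lp.evalCLM ℝ (fun _ : Lattice d => ℂ) 2 k).hasFDerivAt.comp_hasDerivWithinAt t
      (h.deriv_pos t ht)
  have hvd : ∀ k t, 0 ≤ t → HasDerivWithinAt (fun s => v s k)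
      ((a t : ℂ) ^ 2 * discreteLaplacian (u t) k) (Ici 0) t := fun k t ht => by
    obtain ⟨w, hw, hwk⟩ := h.deriv_vel t ht
    rw [← hwk]
    exact (lp.evalCLM ℝ (fun _ : Lattice d => ℂ) 2 k).hasFDerivAt.comp_hasDerivWithinAt t hw
  refine ⟨hsum, fun θ => ⟨?_, ?_, fun t ht => ?_⟩⟩
  · refine continuousOn_dtft_curve (fun T => ?_) (fun k t ht => (hud k t ht).continuousWithinAt) θ
    obtain ⟨B, hB, hB'⟩ := hdom T
    exact ⟨B, hB, fun t ht k => (hB' t ht k).1⟩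
  · refine continuousOn_dtft_curve (fun T => ?_) (fun k t ht => (hvd k t ht).continuousWithinAt) θ
    obtain ⟨B, hB, hB'⟩ := hdom T
    exact ⟨B, hB, fun t ht k => (hB' t ht k).2.1⟩
  · obtain ⟨B, hB, hB'⟩ := hdom (t + 1)
    have hI : Ioo 0 (t + 1) ⊆ Icc 0 (t + 1) := Ioo_subset_Icc_self
    have htI : t ∈ Ioo 0 (t + 1) := ⟨ht, by linarith⟩
    refine ⟨hasDerivAt_dtft hB
      (fun k s hs => (hud k s hs.1.le).hasDerivAt (Ici_mem_nhds hs.1))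
      (fun s hs k => (hB' s (hI hs) k).1) (fun s hs k => (hB' s (hI hs) k).2.1) θ htI, ?_⟩
    have := hasDerivAt_dtft (f := fun s k => v s k)
      (g := fun s k => (a s : ℂ) ^ 2 * discreteLaplacian (u s) k) hB
      (fun k s hs => (hvd k s hs.1.le).hasDerivAt (Ici_mem_nhds hs.1))
      (fun s hs k => (hB' s (hI hs) k).2.1) (fun s hs k => (hB' s (hI hs) k).2.2) θ htI
    refine this.congr_deriv ?_
    have e : dtft (fun k => (a t : ℂ) ^ 2 * discreteLaplacian (u t) k) θ =
        (a t : ℂ) ^ 2 * dtft (discreteLaplacian (u t)) θ := by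
      rw [dtft_eq, dtft_eq, ← tsum_mul_left]
      refine tsum_congr fun k => ?_
      ring
    rw [e, dtft_discreteLaplacian (hsum t ht.le).1]
    ring

end SemiDiscreteWave

namespace SemiDiscreteWave

/-! ### Decay of the data -/

variable {d : ℕ}

theorem norm_lattice_eq (k : Lattice d) : ‖(fun i => (k i : ℝ))‖ = ‖k‖ := by
  have h : ∀ i, ‖((k i : ℤ) : ℝ)‖₊ = ‖k i‖₊ := fun i => NNReal.eq (Int.norm_cast_real _)
  simp only [Pi.norm_def, h]

theorem summable_norm_pow_inv : Summable fun k : Lattice d => (‖k‖ ^ (d + 1))⁻¹ := by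
  set b := (Pi.basisFun ℝ (Fin d)).restrictScalars ℤ with hb
  have hrank : Module.finrank ℤ (Submodule.span ℤ (Set.range (Pi.basisFun ℝ (Fin d)))) = d := by
    rw [Module.finrank_eq_card_basis b, Fintype.card_fin]
  have h := ZLattice.summable_norm_zpow (Submodule.span ℤ (Set.range (Pi.basisFun ℝ (Fin d))))
    (-((d : ℤ) + 1)) (by rw [hrank]; omega)
  have h2 := h.comp_injective b.equivFun.symm.injective
  refine h2.congr fun k => ?_
  have e : ((b.equivFun.symm k : Submodule.span ℤ (Set.range (Pi.basisFun ℝ (Fin d)))) :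
      Fin d → ℝ) = fun i => (k i : ℝ) := by
    rw [Module.Basis.equivFun_symm_apply]
    ext i
    simp [hb, Module.Basis.restrictScalars_apply, Finset.sum_apply, Pi.single_apply]
  rw [Function.comp_apply, Submodule.coe_norm, e, norm_lattice_eq, zpow_neg]
  norm_cast

theorem one_le_norm_of_ne_zero {k : Lattice d} (hk : k ≠ 0) : 1 ≤ ‖k‖ := by
  obtain ⟨i, hi⟩ := Function.ne_iff.1 hk
  refine le_trans ?_ (norm_le_pi_norm k i)
  rw [Int.norm_eq_abs]
  exact_mod_cast Int.one_le_abs hi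

theorem summable_one_add_norm_pow_inv :
    Summable fun k : Lattice d => ((1 + ‖k‖) ^ (d + 1))⁻¹ := by
  -- The comparison fails only at `k = 0`, where the right-hand side is `0⁻¹ = 0`.
  refine Summable.of_norm_bounded_eventually summable_norm_pow_inv ?_
  refine (Set.finite_singleton (0 : Lattice d)).subset fun k hk => ?_
  by_contra h0
  apply hk
  have := one_le_norm_of_ne_zero h0
  change ‖((1 + ‖k‖) ^ (d + 1))⁻¹‖ ≤ (‖k‖ ^ (d + 1))⁻¹
  rw [Real.norm_of_nonneg (by positivity)]
  gcongr
  linarith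

theorem norm_le_latticeNorm (k : Lattice d) : ‖k‖ ≤ latticeNorm k := by
  refine (pi_norm_le_iff_of_nonneg (Real.sqrt_nonneg _)).2 fun i => ?_
  rw [Int.norm_eq_abs]
  refine Real.le_sqrt_of_sq_le ?_
  rw [sq_abs]
  exact Finset.single_le_sum (f := fun i => (k i : ℝ) ^ 2) (fun _ _ => sq_nonneg _)
    (Finset.mem_univ i)

theorem latticeNorm_nonneg (k : Lattice d) : 0 ≤ latticeNorm k := Real.sqrt_nonneg _

/-- The pointwise size of the data in the decay condition. -/
noncomputable def dataSize (u₀ u₁ : Lattice d → ℂ) (k : Lattice d) : ℝ :=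
  (∑ j, ‖fwdDiff j u₀ k‖) + ‖u₁ k‖

theorem dataSize_nonneg (u₀ u₁ : Lattice d → ℂ) (k : Lattice d) : 0 ≤ dataSize u₀ u₁ k := by
  unfold dataSize
  positivity

theorem norm_fwdDiff_le_dataSize (u₀ u₁ : Lattice d → ℂ) (j : Fin d) (k : Lattice d) :
    ‖fwdDiff j u₀ k‖ ≤ dataSize u₀ u₁ k :=
  (Finset.single_le_sum (f := fun j => ‖fwdDiff j u₀ k‖) (fun _ _ => norm_nonneg _)
    (Finset.mem_univ j)).trans (le_add_of_nonneg_right (norm_nonneg _))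

theorem norm_le_dataSize (u₀ u₁ : Lattice d → ℂ) (k : Lattice d) :
    ‖u₁ k‖ ≤ dataSize u₀ u₁ k :=
  le_add_of_nonneg_left (Finset.sum_nonneg fun _ _ => norm_nonneg _)

/-- The supremum defining `T` is bounded below by each of its terms. The constant is the same for
all `n`, which the later optimization in `n` requires. -/
theorem DataDecay.exists_le {M : ℕ → ℝ} (hM : ∀ j, 0 < M j) {ρ : ℝ} (hρ : 0 < ρ)
    {u₀ u₁ : Lattice d → ℂ} (h : DataDecay M ρ u₀ u₁) :
    ∃ C : ℝ, 0 ≤ C ∧ ∀ n, 1 ≤ n → ∀ k,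
      dataSize u₀ u₁ k * latticeNorm k ^ (d + 1) * latticeNorm k ^ n ≤ C * (ρ ^ n * M n) := by
  unfold DataDecay at h
  set S := ⨆ k : Lattice d,
    ENNReal.ofReal (((∑ j, ‖fwdDiff j u₀ k‖) + ‖u₁ k‖) * latticeNorm k ^ (d + 1)) *
      assocFun M (ρ⁻¹ * latticeNorm k)
  refine ⟨S.toReal, ENNReal.toReal_nonneg, fun n hn k => ?_⟩
  have h1 : ENNReal.ofReal (dataSize u₀ u₁ k * latticeNorm k ^ (d + 1) *
      ((ρ⁻¹ * latticeNorm k) ^ n / M n)) ≤ S := by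
    have := latticeNorm_nonneg k
    have := dataSize_nonneg u₀ u₁ k
    rw [ENNReal.ofReal_mul (by positivity)]
    refine le_trans ?_ (le_iSup (fun k => ENNReal.ofReal (((∑ j, ‖fwdDiff j u₀ k‖) + ‖u₁ k‖) *
      latticeNorm k ^ (d + 1)) * assocFun M (ρ⁻¹ * latticeNorm k)) k)
    exact mul_le_mul_right (le_iSup₂ (f := fun j (_ : 1 ≤ j) =>
      ENNReal.ofReal ((ρ⁻¹ * latticeNorm k) ^ j / M j)) n hn) _
  rw [ENNReal.ofReal_le_iff_le_toReal h.ne] at h1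
  have hMn := hM n
  calc dataSize u₀ u₁ k * latticeNorm k ^ (d + 1) * latticeNorm k ^ n
      = dataSize u₀ u₁ k * latticeNorm k ^ (d + 1) *
        ((ρ⁻¹ * latticeNorm k) ^ n / M n) * (ρ ^ n * M n) := by
        rw [mul_pow, inv_pow]
        field_simp
    _ ≤ _ := mul_le_mul_of_nonneg_right h1 (by positivity)

theorem DataDecay.dataSize_le {M : ℕ → ℝ} (hM : ∀ j, 0 < M j) {ρ : ℝ} (hρ : 0 < ρ)
    {u₀ u₁ : Lattice d → ℂ} (h : DataDecay M ρ u₀ u₁) (p : ℕ) :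
    ∃ C : ℝ, 0 ≤ C ∧ ∀ k, (1 + ‖k‖) ^ p * dataSize u₀ u₁ k ≤ C := by
  obtain ⟨C, hC, hdec⟩ := h.exists_le hM hρ
  have hMn := hM (p + 1)
  refine ⟨dataSize u₀ u₁ 0 + 2 ^ (d + 1 + (p + 1)) * (C * (ρ ^ (p + 1) * M (p + 1))),
    add_nonneg (dataSize_nonneg _ _ _) (by positivity), fun k => ?_⟩
  by_cases hk : k = 0
  · subst hk
    simp only [norm_zero, add_zero, one_pow, one_mul]
    exact le_add_of_nonneg_right (by positivity)
  · have h1 := one_le_norm_of_ne_zero hk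
    have h2 := norm_le_latticeNorm k
    have h3 := dataSize_nonneg u₀ u₁ k
    refine le_add_of_nonneg_of_le (dataSize_nonneg _ _ _) ?_
    calc (1 + ‖k‖) ^ p * dataSize u₀ u₁ k
        ≤ (1 + ‖k‖) ^ (d + 1 + (p + 1)) * dataSize u₀ u₁ k := by
          gcongr
          · linarith
          · omega
      _ ≤ (2 * latticeNorm k) ^ (d + 1 + (p + 1)) * dataSize u₀ u₁ k := by
          gcongr
          linarith
      _ = 2 ^ (d + 1 + (p + 1)) *
          (dataSize u₀ u₁ k * latticeNorm k ^ (d + 1) * latticeNorm k ^ (p + 1)) := by ring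
      _ ≤ _ := mul_le_mul_of_nonneg_left (hdec (p + 1) (by omega) k) (by positivity)

theorem fwdDiff_telescope (f : Lattice d → ℂ) (j : Fin d) (k : Lattice d) (N : ℕ) :
    f (k + Pi.single j (N : ℤ)) = f k + ∑ n ∈ Finset.range N, fwdDiff j f (k + Pi.single j (n : ℤ)) := by
  induction N with
  | zero => simp
  | succ N ih =>
    rw [Finset.sum_range_succ, ← add_assoc, ← ih, fwdDiff, add_assoc, ← Pi.single_add]
    push_cast
    ring

theorem tendsto_apply_add_single (f : SqSummable d) (j : Fin d) (k : Lattice d) (s : ℤ)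
    (hs : s ≠ 0) : Tendsto (fun N : ℕ => f (k + Pi.single j (s * N))) atTop (𝓝 0) := by
  have h := ((lp.memℓp f).summable (by simp)).tendsto_cofinite_zero
  simp only [ENNReal.toReal_ofNat, Real.rpow_ofNat] at h
  have hinj : Function.Injective fun N : ℕ => k + Pi.single j (s * (N : ℤ)) := by
    intro N N' hN
    have := congrFun (add_left_cancel hN) j
    simp only [Pi.single_eq_same] at this
    exact_mod_cast mul_left_cancel₀ hs this
  have h2 := h.comp hinj.tendsto_cofinite
  rw [Nat.cofinite_eq_atTop] at h2
  refine tendsto_zero_iff_norm_tendsto_zero.2 ?_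
  have h3 := h2.sqrt
  simpa [Function.comp_def] using h3

theorem summable_inv_sq_add_one : Summable fun n : ℕ => (((n : ℝ) + 1) ^ 2)⁻¹ := by
  have := (summable_nat_add_iff 1).2 (Real.summable_nat_pow_inv (p := 2).2 one_lt_two)
  simpa using this

/-- A square summable sequence inherits the decay of its differences, losing two powers. -/
theorem decay_of_fwdDiff_decay (hd : 1 ≤ d) (f : SqSummable d) {p : ℕ} {C : ℝ} (hC : 0 ≤ C)
    (hf : ∀ j k, (1 + ‖k‖) ^ (p + 2) * ‖fwdDiff j f k‖ ≤ C) (k : Lattice d) :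
    (1 + ‖k‖) ^ p * ‖f k‖ ≤ C * ∑' n : ℕ, (((n : ℝ) + 1) ^ 2)⁻¹ := by
  have : Nonempty (Fin d) := ⟨⟨0, hd⟩⟩
  -- Along a coordinate of largest modulus, `n` steps away from the origin raise the sup norm by at
  -- least `n`. Summing differences outward to infinity, where `f` tends to zero, recovers `f k`;
  -- the two lost powers pay for the series `∑ (n + 1)⁻²`.
  obtain ⟨j, hj⟩ := Finite.exists_max fun i => ‖k i‖
  have hkj : ‖k‖ ≤ |(k j : ℝ)| := by
    rw [← Int.norm_eq_abs]
    exact (pi_norm_le_iff_of_nonneg (norm_nonneg _)).2 hj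
  have hterm : ∀ (l : Lattice d) (n : ℕ), ‖k‖ + n ≤ ‖l‖ →
      (1 + ‖k‖) ^ p * ‖fwdDiff j f l‖ ≤ C * (((n : ℝ) + 1) ^ 2)⁻¹ := by
    intro l n hl
    rw [← div_eq_mul_inv, le_div_iff₀ (by positivity)]
    have hn : (0 : ℝ) ≤ n := n.cast_nonneg
    have hk0 := norm_nonneg k
    calc (1 + ‖k‖) ^ p * ‖fwdDiff j f l‖ * ((n : ℝ) + 1) ^ 2
        ≤ (1 + ‖l‖) ^ p * ‖fwdDiff j f l‖ * (1 + ‖l‖) ^ 2 := by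
          refine mul_le_mul (mul_le_mul_of_nonneg_right ?_ (norm_nonneg _)) ?_ (by positivity)
            (by positivity)
          · exact pow_le_pow_left₀ (by positivity) (by linarith) _
          · exact pow_le_pow_left₀ (by positivity) (by linarith) _
      _ = (1 + ‖l‖) ^ (p + 2) * ‖fwdDiff j f l‖ := by ring
      _ ≤ C := hf j l
  have hsum : ∀ (N : ℕ) (l : ℕ → Lattice d), (∀ n, ‖k‖ + n ≤ ‖l n‖) →
      (1 + ‖k‖) ^ p * ‖∑ n ∈ Finset.range N, fwdDiff j f (l n)‖ ≤
        C * ∑' n : ℕ, (((n : ℝ) + 1) ^ 2)⁻¹ := by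
    intro N l hl
    calc _ ≤ (1 + ‖k‖) ^ p * ∑ n ∈ Finset.range N, ‖fwdDiff j f (l n)‖ := by
          gcongr
          exact norm_sum_le _ _
      _ ≤ ∑ n ∈ Finset.range N, C * (((n : ℝ) + 1) ^ 2)⁻¹ := by
          rw [Finset.mul_sum]
          exact Finset.sum_le_sum fun n _ => hterm _ n (hl n)
      _ ≤ _ := by
          rw [← Finset.mul_sum]
          gcongr
          exact summable_inv_sq_add_one.sum_le_tsum _ fun n _ => by positivity
  rcases le_or_gt 0 (k j) with hpos | hneg
  · have hbd : ∀ N : ℕ, (1 + ‖k‖) ^ p * ‖f k‖ ≤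
        (1 + ‖k‖) ^ p * ‖f (k + Pi.single j (1 * (N : ℤ)))‖ + C * ∑' n : ℕ, (((n : ℝ) + 1) ^ 2)⁻¹ := by
      intro N
      have h1 := fwdDiff_telescope f j k N
      have h2 : f k = f (k + Pi.single j (1 * (N : ℤ))) -
          ∑ n ∈ Finset.range N, fwdDiff j f (k + Pi.single j (n : ℤ)) := by
        rw [one_mul, h1]
        ring
      have h3 := hsum N (fun n => k + Pi.single j (n : ℤ)) fun n => by
        refine le_trans ?_ (norm_le_pi_norm _ j)
        rw [Pi.add_apply, Pi.single_eq_same, Int.norm_eq_abs]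
        push_cast
        have hp : (0 : ℝ) ≤ k j := by exact_mod_cast hpos
        rw [abs_of_nonneg hp] at hkj
        exact (by linarith : ‖k‖ + (n : ℝ) ≤ k j + n).trans (le_abs_self _)
      have h4 : ‖f k‖ ≤ ‖f (k + Pi.single j (1 * (N : ℤ)))‖ +
          ‖∑ n ∈ Finset.range N, fwdDiff j f (k + Pi.single j (n : ℤ))‖ := by
        conv_lhs => rw [h2]
        exact norm_sub_le _ _
      calc _ ≤ (1 + ‖k‖) ^ p * (‖f (k + Pi.single j (1 * (N : ℤ)))‖ +
          ‖∑ n ∈ Finset.range N, fwdDiff j f (k + Pi.single j (n : ℤ))‖) := by gcongr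
        _ ≤ _ := by
          rw [mul_add]
          gcongr
    have hlim := (((tendsto_apply_add_single f j k 1 one_ne_zero).norm.const_mul
      ((1 + ‖k‖) ^ p)).add_const (C * ∑' n : ℕ, (((n : ℝ) + 1) ^ 2)⁻¹))
    rw [norm_zero, mul_zero, zero_add] at hlim
    exact ge_of_tendsto' hlim hbd
  · have hbd : ∀ N : ℕ, (1 + ‖k‖) ^ p * ‖f k‖ ≤
        (1 + ‖k‖) ^ p * ‖f (k + Pi.single j (-1 * (N : ℤ)))‖ +
          C * ∑' n : ℕ, (((n : ℝ) + 1) ^ 2)⁻¹ := by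
      intro N
      have h1 := fwdDiff_telescope f j (k + Pi.single j (-1 * (N : ℤ))) N
      rw [add_assoc, ← Pi.single_add, neg_one_mul, neg_add_cancel, Pi.single_zero, add_zero,
        ← Finset.sum_range_reflect] at h1
      -- Forward differences on the way from `k - N e_j` up to `k` sit at `k - (n + 1) e_j`; the
      -- order is reversed so that the points move outward with `n`.
      have h2 : ∑ n ∈ Finset.range N, fwdDiff j f (k + Pi.single j (-(N : ℤ)) +
          Pi.single j ((N - 1 - n : ℕ) : ℤ)) =
          ∑ n ∈ Finset.range N, fwdDiff j f (k + Pi.single j (-((n : ℤ) + 1))) := by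
        refine Finset.sum_congr rfl fun n hn => ?_
        rw [Finset.mem_range] at hn
        rw [add_assoc, ← Pi.single_add]
        congr 3
        omega
      rw [h2] at h1
      have h3 := hsum N (fun n => k + Pi.single j (-((n : ℤ) + 1))) fun n => by
        refine le_trans ?_ (norm_le_pi_norm _ j)
        rw [Pi.add_apply, Pi.single_eq_same, Int.norm_eq_abs]
        push_cast
        have hp : (k j : ℝ) < 0 := by exact_mod_cast hneg
        rw [abs_of_neg hp] at hkj
        refine le_trans ?_ (neg_le_abs _)
        linarith
      have h4 : ‖f k‖ ≤ ‖f (k + Pi.single j (-1 * (N : ℤ)))‖ +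
          ‖∑ n ∈ Finset.range N, fwdDiff j f (k + Pi.single j (-((n : ℤ) + 1)))‖ := by
        conv_lhs => rw [h1]
        rw [neg_one_mul]
        exact norm_add_le _ _
      calc _ ≤ (1 + ‖k‖) ^ p * (‖f (k + Pi.single j (-1 * (N : ℤ)))‖ +
          ‖∑ n ∈ Finset.range N, fwdDiff j f (k + Pi.single j (-((n : ℤ) + 1)))‖) := by gcongr
        _ ≤ _ := by
          rw [mul_add]
          gcongr
    have hlim := (((tendsto_apply_add_single f j k (-1) (by norm_num)).norm.const_mul
      ((1 + ‖k‖) ^ p)).add_const (C * ∑' n : ℕ, (((n : ℝ) + 1) ^ 2)⁻¹))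
    rw [norm_zero, mul_zero, zero_add] at hlim
    exact ge_of_tendsto' hlim hbd

theorem DataDecay.pointwise_le (hd : 1 ≤ d) {M : ℕ → ℝ} (hM : ∀ j, 0 < M j) {ρ : ℝ} (hρ : 0 < ρ)
    {u₀ u₁ : SqSummable d} (h : DataDecay M ρ u₀ u₁) (p : ℕ) :
    ∃ C : ℝ, 0 ≤ C ∧ ∀ k, (1 + ‖k‖) ^ p * ‖u₀ k‖ ≤ C ∧ (1 + ‖k‖) ^ p * ‖u₁ k‖ ≤ C := by
  obtain ⟨C, hC, hdec⟩ := h.dataSize_le hM hρ (p + 2)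
  obtain ⟨C', hC', hdec'⟩ := h.dataSize_le hM hρ p
  refine ⟨max (C * ∑' n : ℕ, (((n : ℝ) + 1) ^ 2)⁻¹) C', le_max_of_le_right hC', fun k => ⟨?_, ?_⟩⟩
  · refine le_max_of_le_left (decay_of_fwdDiff_decay hd u₀ hC (fun j k => ?_) k)
    refine le_trans ?_ (hdec k)
    gcongr
    exact norm_fwdDiff_le_dataSize _ _ _ _
  · refine le_max_of_le_right (le_trans ?_ (hdec' k))
    gcongr
    exact norm_le_dataSize _ _ _

/-- Half of the `2 (d + 1)` powers form the weight; the other half make the weighted sequence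
summable, hence square summable. -/
theorem exists_weighted_of_decay {f : SqSummable d} {C : ℝ}
    (hf : ∀ k, (1 + ‖k‖) ^ (2 * (d + 1)) * ‖f k‖ ≤ C) :
    ∃ F : SqSummable d, ∀ k, (1 + ‖k‖) ^ (d + 1) * ‖f k‖ ≤ ‖F k‖ := by
  have h1 : Memℓp (fun k : Lattice d => C * ((1 + ‖k‖) ^ (d + 1))⁻¹) 1 := by
    refine memℓp_gen ?_
    simpa using (summable_one_add_norm_pow_inv.mul_left C).norm
  have h2 := h1.of_exponent_ge (p := 2) one_le_two
  have h3 : Memℓp (fun k => (((1 + ‖k‖) ^ (d + 1) : ℝ) : ℂ) * f k) 2 := by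
    refine h2.mono fun k => ?_
    rw [norm_mul, Complex.norm_real, Real.norm_of_nonneg (by positivity), ← div_eq_mul_inv,
      le_div_iff₀ (by positivity)]
    refine le_trans (le_of_eq ?_) (hf k)
    ring
  refine ⟨⟨_, h3⟩, fun k => ?_⟩
  rw [norm_mul, Complex.norm_real, Real.norm_of_nonneg (by positivity)]

theorem one_add_norm_pow_le (k l : Lattice d) (hl : ‖l‖ ≤ 1) (p : ℕ) :
    (1 + ‖k‖) ^ p ≤ 2 ^ p * (1 + ‖k + l‖) ^ p := by
  rw [← mul_pow]
  refine pow_le_pow_left₀ (by positivity) ?_ p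
  have : ‖k‖ ≤ ‖k + l‖ + ‖l‖ := by
    simpa using norm_sub_le (k + l) l
  linarith [norm_nonneg (k + l)]

theorem norm_single_one (j : Fin d) : ‖(Pi.single j 1 : Lattice d)‖ = 1 := by
  rw [Pi.norm_single]
  simp

end SemiDiscreteWave

namespace SemiDiscreteWave

variable {d : ℕ}

/-! ### Vanishing moments and the size of the data in frequency space -/

theorem hasDerivAt_exp_partial_sum (z : ℂ) (n : ℕ) (t : ℝ) :
    HasDerivAt (fun t : ℝ => ∑ j ∈ Finset.range (n + 1), ((t : ℂ) * z) ^ j / (j ! : ℂ))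
      (z * ∑ j ∈ Finset.range n, ((t : ℂ) * z) ^ j / (j ! : ℂ)) t := by
  induction n with
  | zero => simpa using hasDerivAt_const t (1 : ℂ)
  | succ n ih =>
    have h1 : HasDerivAt (fun t : ℝ => ((t : ℂ) * z) ^ (n + 1) / ((n + 1)! : ℂ))
        (z * (((t : ℂ) * z) ^ n / (n ! : ℂ))) t := by
      have h0 : HasDerivAt (fun t : ℝ => (t : ℂ) * z) z t := by
        simpa using (Complex.ofRealCLM.hasDerivAt (x := t)).mul_const z
      refine ((h0.pow (n + 1)).div_const _).congr_deriv ?_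
      rw [Nat.factorial_succ]
      have : (n ! : ℂ) ≠ 0 := by exact_mod_cast n.factorial_ne_zero
      have : (n : ℂ) + 1 ≠ 0 := by exact_mod_cast n.succ_ne_zero
      push_cast
      field_simp
    have := ih.add h1
    rw [Finset.sum_range_succ, mul_add]
    refine this.congr_of_eventuallyEq (.of_forall fun s => ?_)
    exact Finset.sum_range_succ _ _

/-- On the imaginary axis the Taylor remainder carries no exponential factor. Along `t ↦ t z` the
derivative of remainder `n + 1` is `z` times remainder `n`, so the bound integrates up from
`|e^{itx}| = 1`. -/
theorem norm_exp_I_mul_sub_partial_sum_le (x : ℝ) (n : ℕ) :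
    ‖Complex.exp (Complex.I * x) - ∑ j ∈ Finset.range n, (Complex.I * x) ^ j / (j ! : ℂ)‖ ≤
      |x| ^ n / n ! := by
  set z : ℂ := Complex.I * x with hz
  have hzn : ‖z‖ = |x| := by simp [hz]
  have key : ∀ n : ℕ, ∀ t : ℝ, 0 ≤ t →
      ‖Complex.exp (t * z) - ∑ j ∈ Finset.range n, ((t : ℂ) * z) ^ j / (j ! : ℂ)‖ ≤
        (t * |x|) ^ n / n ! := by
    intro n
    induction n with
    | zero =>
      intro t _
      have : (t : ℂ) * z = Complex.I * ((t * x : ℝ) : ℂ) := by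
        rw [hz]
        push_cast
        ring
      simp [this, -Complex.ofReal_mul, Complex.norm_exp_I_mul_ofReal]
    | succ n ih =>
      intro t ht
      have hd : ∀ s : ℝ, HasDerivAt (fun t : ℝ => Complex.exp (t * z) -
          ∑ j ∈ Finset.range (n + 1), ((t : ℂ) * z) ^ j / (j ! : ℂ))
          (z * (Complex.exp (s * z) - ∑ j ∈ Finset.range n, ((s : ℂ) * z) ^ j / (j ! : ℂ))) s := by
        intro s
        have h0 : HasDerivAt (fun t : ℝ => (t : ℂ) * z) z s := by
          simpa using (Complex.ofRealCLM.hasDerivAt (x := s)).mul_const z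
        refine (h0.cexp.sub (hasDerivAt_exp_partial_sum z n s)).congr_deriv ?_
        ring
      refine image_norm_le_of_norm_deriv_right_le_deriv_boundary (a := 0) (b := t)
        (B := fun t => (t * |x|) ^ (n + 1) / ((n + 1)! : ℝ))
        (B' := fun t => |x| * ((t * |x|) ^ n / n !))
        (fun s _ => (hd s).continuousAt.continuousWithinAt)
        (fun s _ => (hd s).hasDerivWithinAt) ?_ ?_ ?_ ⟨ht, le_rfl⟩
      · simp [Finset.sum_range_succ']
      · intro s
        refine ((((hasDerivAt_id s).mul_const |x|).pow (n + 1)).div_const _).congr_deriv ?_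
        rw [Nat.factorial_succ]
        have : (n ! : ℝ) ≠ 0 := by exact_mod_cast n.factorial_ne_zero
        have : (n : ℝ) + 1 ≠ 0 := by exact_mod_cast n.succ_ne_zero
        push_cast
        simp only [id]
        field_simp
      · intro s hs
        rw [norm_mul, hzn]
        exact mul_le_mul_of_nonneg_left (ih s hs.1) (abs_nonneg _)
  simpa using key n 1 zero_le_one

/-- The Euclidean length of a frequency. -/
noncomputable def freqNorm (θ : Fin d → ℝ) : ℝ := Real.sqrt (∑ i, θ i ^ 2)

theorem freqNorm_nonneg (θ : Fin d → ℝ) : 0 ≤ freqNorm θ := Real.sqrt_nonneg _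

theorem abs_sum_mul_le (k : Lattice d) (θ : Fin d → ℝ) :
    |∑ i, (k i : ℝ) * θ i| ≤ latticeNorm k * freqNorm θ := by
  rw [latticeNorm, freqNorm, ← Real.sqrt_mul (Finset.sum_nonneg fun _ _ => sq_nonneg _)]
  exact Real.abs_le_sqrt (Finset.sum_mul_sq_le_sq_mul_sq _ _ _)

/-- Jordan's inequality `(2 / π) |x| ≤ |sin x|` on `[-π/2, π/2]`, coordinatewise; this is the source
of the factor `π / 2` in `κ = π ρ / 2`. -/
theorem freqNorm_le {θ : Fin d → ℝ} (hθ : θ ∈ freqBox d) :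
    freqNorm θ ≤ Real.pi / 2 * xiNorm θ := by
  have hpi := Real.pi_pos
  rw [freqNorm, Real.sqrt_le_left (mul_nonneg (by positivity) (xiNorm_nonneg θ)), mul_pow,
    xiNorm_sq, Finset.mul_sum]
  refine Finset.sum_le_sum fun i _ => ?_
  have h1 : |θ i / 2| ≤ Real.pi / 2 := abs_le.2 ⟨by linarith [hθ.1 i], by linarith [hθ.2 i]⟩
  have h2 := Real.mul_abs_le_abs_sin h1
  rw [← mul_pow]
  refine sq_le_sq.2 ?_
  rw [abs_mul, abs_mul, abs_of_pos (by positivity : 0 < Real.pi / 2), abs_two]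
  rw [abs_div, abs_two, div_mul_div_comm, div_le_iff₀ (by positivity)] at h2
  linarith

/-- The multinomial theorem writes `(k·θ)^n` as a finite combination of monomials in `k`. -/
theorem VanishingMoments.hasSum_pow {f : Lattice d → ℂ} (hf : VanishingMoments f)
    (θ : Fin d → ℝ) (n : ℕ) :
    HasSum (fun k : Lattice d => (∑ i, (k i : ℂ) * (θ i : ℂ)) ^ n * f k) 0 := by
  have h := hasSum_sum (s := (Finset.univ : Finset (Fin d)).piAntidiag n) fun α _ =>
    (hf α).mul_left ((Nat.multinomial Finset.univ α : ℂ) * ∏ i, (θ i : ℂ) ^ α i)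
  simp only [mul_zero, Finset.sum_const_zero] at h
  refine h.congr_fun fun k => ?_
  rw [Finset.sum_pow_eq_sum_piAntidiag, Finset.sum_mul]
  refine Finset.sum_congr rfl fun α _ => ?_
  simp only [mul_pow, Finset.prod_mul_distrib]
  ring

/-- Vanishing moments make the transform small near the zero frequency. -/
theorem VanishingMoments.norm_dtft_le {f : Lattice d → ℂ} (hf : VanishingMoments f)
    (hs : Summable fun k => ‖f k‖) {n : ℕ} {D : ℝ} (hn : 1 ≤ n) (hD0 : 0 ≤ D)
    (hD : ∀ k, ‖f k‖ * latticeNorm k ^ (d + 1) * latticeNorm k ^ n ≤ D) (θ : Fin d → ℝ) :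
    ‖dtft f θ‖ ≤ freqNorm θ ^ n / n ! * (D * ∑' k : Lattice d, (‖k‖ ^ (d + 1))⁻¹) := by
  -- The Taylor polynomial of `e^{-ik·θ}` of degree `n - 1` contributes nothing to the transform, so
  -- only the remainder, of size `|k·θ|^n / n!`, is left.
  have hmom : HasSum (fun k : Lattice d => (∑ j ∈ Finset.range n,
      (Complex.I * ((-∑ i, (k i : ℝ) * θ i : ℝ) : ℂ)) ^ j / (j ! : ℂ)) * f k) 0 := by
    have h := hasSum_sum (s := Finset.range n) fun j _ =>
      (hf.hasSum_pow θ j).mul_left ((-Complex.I) ^ j / (j ! : ℂ))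
    simp only [mul_zero, Finset.sum_const_zero] at h
    refine h.congr_fun fun k => ?_
    rw [Finset.sum_mul]
    refine Finset.sum_congr rfl fun j _ => ?_
    push_cast
    rw [mul_neg, ← neg_mul, mul_pow]
    ring
  have h1 := (summable_latticeChar_mul hs θ).hasSum.sub hmom
  rw [sub_zero, ← dtft_eq] at h1
  rw [← h1.tsum_eq]
  have hb : ∀ k : Lattice d, ‖latticeChar k θ * f k - (∑ j ∈ Finset.range n,
      (Complex.I * ((-∑ i, (k i : ℝ) * θ i : ℝ) : ℂ)) ^ j / (j ! : ℂ)) * f k‖ ≤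
      freqNorm θ ^ n / n ! * (D * (‖k‖ ^ (d + 1))⁻¹) := by
    intro k
    rw [← sub_mul, norm_mul, latticeChar_eq]
    have e1 := norm_exp_I_mul_sub_partial_sum_le (-∑ i, (k i : ℝ) * θ i) n
    rw [abs_neg] at e1
    have e2 : |∑ i, (k i : ℝ) * θ i| ^ n ≤ (latticeNorm k * freqNorm θ) ^ n :=
      pow_le_pow_left₀ (abs_nonneg _) (abs_sum_mul_le k θ) n
    have hθ := freqNorm_nonneg θ
    have e3 : latticeNorm k ^ n * ‖f k‖ ≤ D * (‖k‖ ^ (d + 1))⁻¹ := by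
      by_cases hk : k = 0
      · subst hk
        have : latticeNorm (0 : Lattice d) = 0 := by simp [latticeNorm]
        rw [this, zero_pow (by omega), zero_mul]
        positivity
      · have h1 := one_le_norm_of_ne_zero hk
        have h2 := norm_le_latticeNorm k
        have h3 := latticeNorm_nonneg k
        rw [← div_eq_mul_inv, le_div_iff₀ (by positivity)]
        refine le_trans ?_ (hD k)
        calc latticeNorm k ^ n * ‖f k‖ * ‖k‖ ^ (d + 1)
            ≤ latticeNorm k ^ n * ‖f k‖ * latticeNorm k ^ (d + 1) := by gcongr
          _ = _ := by ring
    calc _ ≤ (latticeNorm k * freqNorm θ) ^ n / n ! * ‖f k‖ := by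
          refine mul_le_mul_of_nonneg_right (e1.trans ?_) (norm_nonneg _)
          gcongr
      _ = freqNorm θ ^ n / n ! * (latticeNorm k ^ n * ‖f k‖) := by ring
      _ ≤ _ := by gcongr
  have hsm := (summable_norm_pow_inv (d := d)).mul_left D |>.mul_left (freqNorm θ ^ n / n !)
  refine (tsum_of_norm_bounded hsm.hasSum hb).trans (le_of_eq ?_)
  rw [tsum_mul_left, tsum_mul_left]

theorem energyDensity_nonneg (c : ℝ) (f g : Lattice d → ℂ) (θ : Fin d → ℝ) :
    0 ≤ energyDensity c f g θ := by
  unfold energyDensity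
  positivity

/-- The moment bound is applied to `u₁` and to the differences of `u₀`, using `∑_j` of `|(D_j^+
u₀)^|²` equal to `|ξ|² |û₀|²`. The constant is independent of `n` and `θ`. -/
theorem sqrt_energyDensity_le {M : ℕ → ℝ} (hM : ∀ j, 0 < M j) {ρ : ℝ} (hρ : 0 < ρ) (c : ℝ)
    {u₀ u₁ : Lattice d → ℂ} (h₀ : Summable fun k => ‖u₀ k‖) (h₁ : Summable fun k => ‖u₁ k‖)
    (hmom : DataMoments u₀ u₁) (hdec : DataDecay M ρ u₀ u₁) :
    ∃ C : ℝ, 0 ≤ C ∧ ∀ θ ∈ freqBox d, ∀ n, 1 ≤ n → Real.sqrt (energyDensity c u₀ u₁ θ) ≤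
      C * ((Real.pi * ρ / 2 * xiNorm θ) ^ n * (M n / n !)) := by
  obtain ⟨C, hC, hd⟩ := hdec.exists_le hM hρ
  set S := ∑' k : Lattice d, (‖k‖ ^ (d + 1))⁻¹ with hS
  have hS0 : 0 ≤ S := tsum_nonneg fun k => by positivity
  have hpi := Real.pi_pos
  refine ⟨Real.sqrt (1 + c ^ 2 * d) * (C * S), by positivity, fun θ hθ n hn => ?_⟩
  have hMn := hM n
  have hxi := xiNorm_nonneg θ
  set Y := C * S * ((Real.pi * ρ / 2 * xiNorm θ) ^ n * (M n / n !)) with hY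
  have hY0 : 0 ≤ Y := by positivity
  have hone : ∀ f : Lattice d → ℂ, VanishingMoments f → (Summable fun k => ‖f k‖) →
      (∀ k, ‖f k‖ ≤ dataSize u₀ u₁ k) → ‖dtft f θ‖ ≤ Y := by
    intro f hf hs hfd
    refine (hf.norm_dtft_le hs hn (D := C * (ρ ^ n * M n)) (by positivity) (fun k => ?_) θ).trans ?_
    · refine le_trans ?_ (hd n hn k)
      have := latticeNorm_nonneg k
      have := hfd k
      gcongr
    · have h1 := freqNorm_le hθ
      have h2 := freqNorm_nonneg θ
      calc _ ≤ (Real.pi / 2 * xiNorm θ) ^ n / n ! * (C * (ρ ^ n * M n) * S) := by gcongr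
        _ = _ := by
          rw [hY, show Real.pi * ρ / 2 * xiNorm θ = (Real.pi / 2 * xiNorm θ) * ρ by ring, mul_pow _ ρ]
          ring
  have e1 := hone u₁ hmom.2 h₁ (norm_le_dataSize u₀ u₁)
  have e2 : ∀ j, ‖dtft (fwdDiff j u₀) θ‖ ≤ Y := fun j =>
    hone _ (hmom.1 j) (summable_norm_fwdDiff h₀ j) (norm_fwdDiff_le_dataSize u₀ u₁ j)
  rw [mul_assoc, ← hY, Real.sqrt_le_left (by positivity), mul_pow,
    Real.sq_sqrt (by positivity), energyDensity, mul_assoc, ← sum_norm_dtft_fwdDiff_sq h₀]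
  calc _ ≤ Y ^ 2 + c ^ 2 * ∑ _j : Fin d, Y ^ 2 := by
        gcongr with j _
        exact e2 j
    _ = _ := by
        simp
        ring

theorem energyDensity_le {c : ℝ} {u₀ u₁ : Lattice d → ℂ} (h₀ : Summable fun k => ‖u₀ k‖)
    (h₁ : Summable fun k => ‖u₁ k‖) (θ : Fin d → ℝ) :
    energyDensity c u₀ u₁ θ ≤
      (∑' k, ‖u₁ k‖) ^ 2 + c ^ 2 * (2 * Real.sqrt d) ^ 2 * (∑' k, ‖u₀ k‖) ^ 2 := by
  have e1 := SemiDiscreteWave.norm_dtft_le h₀ θ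
  have e2 := SemiDiscreteWave.norm_dtft_le h₁ θ
  have e3 := xiNorm_le θ
  have e4 := xiNorm_nonneg θ
  unfold energyDensity
  gcongr

/-- Finiteness of the weighted energy of data with vanishing moments and decay. -/
theorem weightedEnergy_lt_top {a Θ Λ : ℝ → ℝ} (hW : AdmissibleWeights Θ Λ) {M : ℕ → ℝ}
    (hM : ∀ j, 0 < M j) {ρ N N₀ : ℝ} (hρ : 0 < ρ) (hN₀ : 0 ≤ N₀)
    (hL : 0 < dominationConst Θ Λ M N)
    (hcmp : ∀ lam, 0 < lam → lam ≤ 2 * Real.sqrt d → Θ (halfLineInv Λ (N₀ / lam)) ≤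
      Real.pi * ρ / 2 * Θ (halfLineInv Λ (N / (Real.pi * ρ / 2 * lam))))
    {u₀ u₁ : Lattice d → ℂ} (h₀ : Summable fun k => ‖u₀ k‖) (h₁ : Summable fun k => ‖u₁ k‖)
    (hmom : DataMoments u₀ u₁) (hdec : DataDecay M ρ u₀ u₁) :
    weightedEnergy a Θ Λ N₀ u₀ u₁ < ∞ := by
  obtain ⟨C, hC, hE⟩ := sqrt_energyDensity_le hM hρ (a 0) h₀ h₁ hmom hdec
  have hpi := Real.pi_pos
  set κ := Real.pi * ρ / 2 with hκ
  have hκ0 : 0 < κ := by positivity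
  -- The infimum may be infinite, so it is cut off at `1` to obtain a real constant.
  obtain ⟨L, hL0, hLle⟩ : ∃ L : ℝ, 0 < L ∧ ENNReal.ofReal L ≤ dominationConst Θ Λ M N := by
    refine ⟨(min (dominationConst Θ Λ M N) 1).toReal, ?_, ?_⟩
    · exact ENNReal.toReal_pos (lt_min hL one_pos).ne'
        (ne_top_of_le_ne_top ENNReal.one_ne_top (min_le_right _ _))
    · exact ENNReal.ofReal_toReal_le.trans (min_le_left _ _)
  set Em := (∑' k, ‖u₁ k‖) ^ 2 + (a 0) ^ 2 * (2 * Real.sqrt d) ^ 2 * (∑' k, ‖u₀ k‖) ^ 2 with hEm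
  have hEm0 : 0 ≤ Em := by positivity
  set B₁ := Real.exp (2 * (2 * Real.sqrt d) * Θ (halfLineInv Λ (N₀ * κ))) with hB₁
  have hbound : ∀ θ ∈ freqBox d, Real.exp (2 * xiNorm θ * Θ (halfLineInv Λ (N₀ / xiNorm θ))) *
      energyDensity (a 0) u₀ u₁ θ ≤ max ((C / L) ^ 2) (max Em (B₁ * Em)) := by
    intro θ hθ
    have hEn := energyDensity_nonneg (a 0) u₀ u₁ θ
    have hEle : energyDensity (a 0) u₀ u₁ θ ≤ Em := energyDensity_le h₀ h₁ θ
    have hxb := xiNorm_le θ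
    rcases (xiNorm_nonneg θ).eq_or_lt with h0 | hpos
    · rw [← h0]
      simp only [mul_zero, zero_mul, Real.exp_zero, one_mul]
      exact hEle.trans ((le_max_left _ _).trans (le_max_right _ _))
    set lam := xiNorm θ with hlam
    -- For `κλ > 1` the weight is bounded, since `N₀ / λ ≤ N₀ κ`. For `κλ ≤ 1` the point `τ = 1 /
    -- (κλ) ≥ 1` is admissible in the infimum defining `L`.
    rcases lt_or_ge 1 (κ * lam) with hbig | hsmall
    · refine le_trans ?_ ((le_max_right _ _).trans (le_max_right _ _))
      have h1 : N₀ / lam ≤ N₀ * κ := by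
        rw [div_le_iff₀ hpos]
        nlinarith
      have h2 : Θ (halfLineInv Λ (N₀ / lam)) ≤ Θ (halfLineInv Λ (N₀ * κ)) := hW.comp_mono h1
      have h3 := hW.num_pos _ (halfLineInv_nonneg Λ (N₀ / lam))
      rw [hB₁]
      gcongr
    · refine le_trans ?_ (le_max_left _ _)
      set τ := (κ * lam)⁻¹ with hτ
      have hτ1 : 1 ≤ τ := (one_le_inv₀ (by positivity)).2 hsmall
      have hτ0 : 0 < τ := by positivity
      set s := Real.sqrt (energyDensity (a 0) u₀ u₁ θ) with hs
      have hs0 : 0 ≤ s := Real.sqrt_nonneg _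
      -- Taking the supremum over `n` of the bounds `s τ^n / (M_n / n!) ≤ C` is the optimization in
      -- `n`.
      have h1 : ENNReal.ofReal s * assocFun (fun j => M j / (j ! : ℝ)) τ ≤ ENNReal.ofReal C := by
        rw [assocFun, ENNReal.mul_iSup]
        refine iSup_le fun n => ?_
        rw [ENNReal.mul_iSup]
        refine iSup_le fun hn => ?_
        rw [← ENNReal.ofReal_mul hs0]
        refine ENNReal.ofReal_le_ofReal ?_
        have hMn := hM n
        have hfac : (0 : ℝ) < n ! := by exact_mod_cast n.factorial_pos
        have hq : 0 < M n / n ! := by positivity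
        calc s * (τ ^ n / (M n / n !)) ≤
            C * ((κ * lam) ^ n * (M n / n !)) * (τ ^ n / (M n / n !)) := by
              have := hE θ hθ n hn
              gcongr
          _ = C := by
            rw [hτ, inv_pow]
            field_simp
      have h2 : ENNReal.ofReal (L * Real.exp (τ⁻¹ * Θ (halfLineInv Λ (N * τ)))) ≤
          assocFun (fun j => M j / (j ! : ℝ)) τ := by
        rw [ENNReal.ofReal_mul hL0.le]
        exact ENNReal.mul_le_of_le_div (hLle.trans (iInf₂_le τ hτ1))
      have h3 : s * (L * Real.exp (τ⁻¹ * Θ (halfLineInv Λ (N * τ)))) ≤ C := by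
        have := (mul_le_mul_right h2 (ENNReal.ofReal s)).trans h1
        rw [← ENNReal.ofReal_mul hs0] at this
        exact (ENNReal.ofReal_le_ofReal_iff hC).1 this
      have h4 : lam * Θ (halfLineInv Λ (N₀ / lam)) ≤ τ⁻¹ * Θ (halfLineInv Λ (N * τ)) := by
        have := mul_le_mul_of_nonneg_left (hcmp lam hpos hxb) hpos.le
        refine this.trans (le_of_eq ?_)
        rw [hτ, inv_inv, ← div_eq_mul_inv]
        ring
      have h5 : Real.exp (lam * Θ (halfLineInv Λ (N₀ / lam))) * s ≤ C / L := by
        rw [le_div_iff₀ hL0]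
        refine le_trans ?_ h3
        have := Real.exp_le_exp.2 h4
        calc _ ≤ Real.exp (τ⁻¹ * Θ (halfLineInv Λ (N * τ))) * s * L := by gcongr
          _ = _ := by ring
      have h6 := pow_le_pow_left₀ (by positivity) h5 2
      rw [mul_pow, hs, Real.sq_sqrt hEn, ← Real.exp_nat_mul] at h6
      refine le_trans (le_of_eq ?_) h6
      push_cast
      ring_nf
  rw [weightedEnergy]
  refine lt_of_le_of_lt (setLIntegral_mono_ae' (g := fun _ =>
    ENNReal.ofReal (max ((C / L) ^ 2) (max Em (B₁ * Em)))) measurableSet_Icc (.of_forall fun θ hθ =>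
      ENNReal.ofReal_le_ofReal (hbound θ hθ))) ?_
  rw [setLIntegral_const]
  exact ENNReal.mul_lt_top ENNReal.ofReal_lt_top isCompact_Icc.measure_lt_top

/-! ### The energy estimate -/

/-- Real and imaginary parts of a complex mode are real modes because the coefficients are real, and
the energies add. -/
theorem energyDensity_le_of_mode {a : ℝ → ℝ} {b B E : ℝ} {t : ℝ} {V W : ℝ → ℂ}
    (hmode : ∀ v w : ℝ → ℝ, RealMode a b v w →
      w t ^ 2 + a t ^ 2 * b ^ 2 * v t ^ 2 ≤ B * E * (w 0 ^ 2 + a 0 ^ 2 * b ^ 2 * v 0 ^ 2))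
    (hV : ContinuousOn V (Ici 0)) (hW : ContinuousOn W (Ici 0))
    (hVW : ∀ t, 0 < t → HasDerivAt V (W t) t ∧
      HasDerivAt W (-((a t : ℂ) ^ 2 * (b : ℂ) ^ 2 * V t)) t) :
    ‖W t‖ ^ 2 + a t ^ 2 * b ^ 2 * ‖V t‖ ^ 2 ≤
      B * E * (‖W 0‖ ^ 2 + a 0 ^ 2 * b ^ 2 * ‖V 0‖ ^ 2) := by
  have hre := hmode (fun t => (V t).re) (fun t => (W t).re)
    { cont_pos := Complex.continuous_re.comp_continuousOn hV
      cont_vel := Complex.continuous_re.comp_continuousOn hW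
      deriv_pos := fun t ht => Complex.reCLM.hasFDerivAt.comp_hasDerivAt t (hVW t ht).1
      deriv_vel := fun t ht =>
        (Complex.reCLM.hasFDerivAt.comp_hasDerivAt t (hVW t ht).2).congr_deriv (by
          simp only [Complex.reCLM_apply, ← Complex.ofReal_pow, ← Complex.ofReal_mul,
            Complex.neg_re, Complex.re_ofReal_mul]) }
  have him := hmode (fun t => (V t).im) (fun t => (W t).im)
    { cont_pos := Complex.continuous_im.comp_continuousOn hV
      cont_vel := Complex.continuous_im.comp_continuousOn hW
      deriv_pos := fun t ht => Complex.imCLM.hasFDerivAt.comp_hasDerivAt t (hVW t ht).1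
      deriv_vel := fun t ht =>
        (Complex.imCLM.hasFDerivAt.comp_hasDerivAt t (hVW t ht).2).congr_deriv (by
          simp only [Complex.imCLM_apply, ← Complex.ofReal_pow, ← Complex.ofReal_mul,
            Complex.neg_im, Complex.im_ofReal_mul]) }
  simp only [Complex.sq_norm, Complex.normSq_apply]
  linarith

theorem energy_le_weightedEnergy {a Θ Λ : ℝ → ℝ} {N B : ℝ} (hB : 0 ≤ B)
    {f g u₀ u₁ : Lattice d → ℂ} {c : ℝ} (hf : Summable fun k => ‖f k‖)
    (hg : Summable fun k => ‖g k‖)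
    (h : ∀ θ, energyDensity c f g θ ≤ B * Real.exp (2 * xiNorm θ *
      Θ (halfLineInv Λ (N / xiNorm θ))) * energyDensity (a 0) u₀ u₁ θ) :
    energy c f g ≤ (B / (2 * Real.pi) ^ d).toNNReal * weightedEnergy a Θ Λ N u₀ u₁ := by
  have hpi : 0 < (2 * Real.pi) ^ d := by have := Real.pi_pos; positivity
  have h1 : ENNReal.ofReal ((2 * Real.pi) ^ d) * energy c f g ≤
      ENNReal.ofReal B * weightedEnergy a Θ Λ N u₀ u₁ := by
    rw [energy_eq_lintegral hf hg, weightedEnergy, ← lintegral_const_mul' _ _ ENNReal.ofReal_ne_top]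
    refine lintegral_mono fun θ => ?_
    rw [← ENNReal.ofReal_mul hB, ← mul_assoc]
    exact ENNReal.ofReal_le_ofReal (h θ)
  have h2 : ((B / (2 * Real.pi) ^ d).toNNReal : ℝ≥0∞) =
      ENNReal.ofReal B / ENNReal.ofReal ((2 * Real.pi) ^ d) :=
    ENNReal.ofReal_div_of_pos hpi
  rw [h2, ENNReal.mul_comm_div, ← mul_div_assoc, ENNReal.le_div_iff_mul_le
    (.inl (ENNReal.ofReal_pos.2 hpi).ne') (.inl ENNReal.ofReal_ne_top), mul_comm]
  exact h1

end SemiDiscreteWave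

/-! ### Proof of the theorem: choice of the parameters -/

theorem theorem3p3 {d m : ℕ} (hd : 1 ≤ d) (hm : 2 ≤ m)
    (a Θ Ξ Λ : ℝ → ℝ) (M : ℕ → ℝ)
    -- the propagation speed is bounded above and away from zero
    (ha : ∃ a₀ a₁ : ℝ, 0 < a₀ ∧ ∀ t, 0 ≤ t → a₀ ≤ a t ∧ a t ≤ a₁)
    -- `Θ`, `Ξ`, `Λ` are positive and increasing on `[0, ∞)`
    (hΘpos : ∀ t, 0 ≤ t → 0 < Θ t) (hΘmono : MonotoneOn Θ (Ici 0))
    (hΞpos : ∀ t, 0 ≤ t → 0 < Ξ t) (hΞmono : MonotoneOn Ξ (Ici 0))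
    (hΛpos : ∀ t, 0 ≤ t → 0 < Λ t) (hΛmono : StrictMonoOn Λ (Ici 0))
    (hΛcont : ContinuousOn Λ (Ici 0)) (hΛlim : Tendsto Λ atTop atTop)
    -- stabilization of `a` towards a constant
    (hstab : ∃ aInf : ℝ, 0 < aInf ∧ ∀ t, 0 ≤ t → (∫ s in (0 : ℝ)..t, |a s - aInf|) ≤ Θ t)
    -- smoothness of `a` and bounds for its derivatives
    (hsmooth : ContDiffOn ℝ m a (Ici 0))
    (hderiv : ∃ C : ℕ → ℝ, ∀ k, 1 ≤ k → k ≤ m → ∀ t, 0 ≤ t →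
      |iteratedDerivWithin k a (Ici 0) t| ≤ C k * (Ξ t ^ k)⁻¹)
    -- `Θ / Λ` increases to infinity
    (hratio : MonotoneOn (fun t => Θ t / Λ t) (Ici 0))
    (hratioLim : Tendsto (fun t => Θ t / Λ t) atTop atTop)
    (hΛΞ : ∃ C₀ : ℝ, 0 < C₀ ∧ ∀ t, 0 ≤ t → Λ t ≤ C₀ * Ξ t)
    (hΞint : IntegrableOn (fun s => (Ξ s ^ m)⁻¹) (Ioi 0))
    (hΞtail : ∃ K : ℝ, ∀ t, 0 ≤ t → Λ t ^ m * (Θ t)⁻¹ * (∫ s in Ioi t, (Ξ s ^ m)⁻¹) ≤ K)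
    -- the weight sequence
    (hMpos : ∀ j, 0 < M j) (hMconv : LogConvexSeq M)
    (hL : ∃ N : ℝ, 0 < N ∧ 0 < dominationConst Θ Λ M N) :
    -- (i)
    ((∀ N : ℝ, 0 < N → 0 < dominationConst Θ Λ M N) →
      ∀ ρ : ℝ, 0 < ρ → ∃ N₀ : ℝ, 0 < N₀ ∧ ∃ C : ℝ≥0, ∀ u₀ u₁ : SqSummable d,
        DataMoments u₀ u₁ → DataDecay M ρ u₀ u₁ →
          weightedEnergy a Θ Λ N₀ u₀ u₁ < ∞ ∧
          ∀ u v : ℝ → SqSummable d, IsSolution a u₀ u₁ u v → ∀ t, 0 ≤ t →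
            energy (a t) (u t) (v t) ≤ C * weightedEnergy a Θ Λ N₀ u₀ u₁) ∧
    -- (ii)
    (Tendsto (fun N : ℝ => ⨅ (τ : ℝ) (_ : 1 / (2 * Real.sqrt d) ≤ τ),
        ENNReal.ofReal (Θ (halfLineInv Λ (N * τ)) / (N * Θ (halfLineInv Λ τ)))) atTop (𝓝 ∞) →
      ∃ ρ : ℝ, 0 < ρ ∧ ∃ N₀ : ℝ, 0 < N₀ ∧ ∃ C : ℝ≥0, ∀ u₀ u₁ : SqSummable d,
        DataMoments u₀ u₁ → DataDecay M ρ u₀ u₁ →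
          weightedEnergy a Θ Λ N₀ u₀ u₁ < ∞ ∧
          ∀ u v : ℝ → SqSummable d, IsSolution a u₀ u₁ u v → ∀ t, 0 ≤ t →
            energy (a t) (u t) (v t) ≤ C * weightedEnergy a Θ Λ N₀ u₀ u₁) := by
  obtain ⟨a₀, a₁, ha₀, hab⟩ := ha
  obtain ⟨aInf, haInf, hstab⟩ := hstab
  obtain ⟨C, hC⟩ := hderiv
  obtain ⟨C₀, hC₀, hΛΞ⟩ := hΛΞ
  obtain ⟨K, hK⟩ := hΞtail
  obtain ⟨N₁, hN₁, hL₁⟩ := hL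
  have hW : AdmissibleWeights Θ Λ := ⟨hΘpos, hΘmono, hΛpos, hΛmono, hΛcont, hΛlim, hratio⟩
  have habs : ∀ t, 0 ≤ t → |a t| ≤ a₁ := fun t ht =>
    abs_le.2 ⟨by linarith [hab t ht], (hab t ht).2⟩
  have hsym : IsSymbol Ξ m 0 (fun _ t => (a t : ℂ)) := by
    -- The derivative bounds start at order one; order zero is supplied by `a₁`.
    have := isSymbol_of_deriv_le hΞpos hsmooth (C := fun k => if k = 0 then a₁ else C k)
      (fun k hk t ht => ?_) m 0 (zero_add m)
    · simpa using this
    · rcases Nat.eq_zero_or_pos k with rfl | hk0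
      · simpa using habs t ht
      · simpa [hk0.ne'] using hC k hk0 hk t ht
  have hsd : 0 < Real.sqrt d := Real.sqrt_pos.2 (by exact_mod_cast hd)
  have hb : 0 < 2 * Real.sqrt d := by positivity
  obtain ⟨N₀, B, hN₀, hN₀b, hB, hmode⟩ := exists_mode_energy_le (by omega) ha₀
    (fun t ht => (hab t ht).1) (fun t ht => (hab t ht).2) hsmooth.continuousOn hΞpos hΞmono hsym
    hW haInf hstab hC₀ hΛΞ hΞint hK (b := 2 * Real.sqrt d)
  have hN₀0 : 0 < N₀ := by linarith
  -- Both parts reduce to one comparison: with `κ = πρ/2`, the weight exponent with parameter `N₀`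
  -- must not exceed the decay exponent of the data with parameter `N`.
  have core : ∀ ρ N : ℝ, 0 < ρ → 0 < dominationConst Θ Λ M N →
      (∀ lam, 0 < lam → lam ≤ 2 * Real.sqrt d → Θ (halfLineInv Λ (N₀ / lam)) ≤
        Real.pi * ρ / 2 * Θ (halfLineInv Λ (N / (Real.pi * ρ / 2 * lam)))) →
      ∃ N₀ : ℝ, 0 < N₀ ∧ ∃ C : ℝ≥0, ∀ u₀ u₁ : SqSummable d,
        DataMoments u₀ u₁ → DataDecay M ρ u₀ u₁ →
          weightedEnergy a Θ Λ N₀ u₀ u₁ < ∞ ∧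
          ∀ u v : ℝ → SqSummable d, IsSolution a u₀ u₁ u v → ∀ t, 0 ≤ t →
            energy (a t) (u t) (v t) ≤ C * weightedEnergy a Θ Λ N₀ u₀ u₁ := by
    intro ρ N hρ hL hcmp
    refine ⟨N₀, hN₀0, (B / (2 * Real.pi) ^ d).toNNReal, fun u₀ u₁ hmom hdec => ?_⟩
    obtain ⟨D, -, hD⟩ := hdec.pointwise_le hd hMpos hρ (2 * (d + 1))
    obtain ⟨F₀, hF₀⟩ := exists_weighted_of_decay fun k => (hD k).1
    obtain ⟨F₁, hF₁⟩ := exists_weighted_of_decay fun k => (hD k).2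
    have hsummable : ∀ f : SqSummable d, (∀ k, (1 + ‖k‖) ^ (2 * (d + 1)) * ‖f k‖ ≤ D) →
        Summable fun k => ‖f k‖ := by
      intro f hf
      refine .of_nonneg_of_le (fun _ => norm_nonneg _) (fun k => ?_)
        (summable_one_add_norm_pow_inv.mul_left D)
      rw [← div_eq_mul_inv, le_div_iff₀ (by positivity), mul_comm]
      refine le_trans ?_ (hf k)
      gcongr
      · linarith [norm_nonneg k]
      · omega
    have h₀ := hsummable u₀ fun k => (hD k).1
    have h₁ := hsummable u₁ fun k => (hD k).2
    refine ⟨weightedEnergy_lt_top hW hMpos hρ hN₀0.le hL hcmp h₀ h₁ hmom hdec,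
      fun u v hu t ht => ?_⟩
    obtain ⟨hsum, hode⟩ := hu.dtft_mode habs (ω := fun k => (1 + ‖k‖) ^ (d + 1))
      (c := 2 ^ (d + 1)) (fun k => by positivity) summable_one_add_norm_pow_inv
      (one_le_pow₀ one_le_two)
      (fun j k => one_add_norm_pow_le k _ (norm_single_one j).le (d + 1))
      (fun j k => by
        have := one_add_norm_pow_le k (-Pi.single j 1)
          (by rw [norm_neg, norm_single_one]) (d + 1)
        rwa [← sub_eq_add_neg] at this) F₀ F₁ hF₀ hF₁
    refine energy_le_weightedEnergy hB (hsum t ht).1 (hsum t ht).2 fun θ => ?_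
    obtain ⟨hV, hW', hd'⟩ := hode θ
    have := energyDensity_le_of_mode (a := a) (b := xiNorm θ) (t := t)
      (V := fun t => dtft (u t) θ) (W := fun t => dtft (v t) θ)
      (fun x y hxy => hmode (xiNorm θ) (xiNorm_nonneg θ) (xiNorm_le θ) x y hxy t ht) hV hW' hd'
    rwa [hu.init_pos, hu.init_vel] at this
  have hpi := Real.pi_pos
  refine ⟨fun hLall ρ hρ => ?_, fun hlim => ?_⟩
  · set κ := Real.pi * ρ / 2 with hκ
    have hκ0 : 0 < κ := by positivity
    -- For `κ ≥ 1` this choice makes the two arguments of `Λ⁻¹` equal. For `κ ≤ 1` the argument on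
    -- the right is `κ⁻¹` times that on the left, and `mul_comp_le` supplies the missing factor.
    refine core ρ (N₀ * max κ 1) hρ (hLall _ (by positivity)) fun lam hlam hle => ?_
    rw [← hκ]
    rcases le_total 1 κ with h1 | h1
    · rw [max_eq_left h1, show N₀ * κ / (κ * lam) = N₀ / lam by field_simp]
      exact le_mul_of_one_le_left (hW.num_pos _ (halfLineInv_nonneg _ _)).le h1
    · rw [max_eq_right h1, mul_one]
      have h2 : Λ 0 ≤ N₀ / lam := by
        rw [le_div_iff₀ hlam, mul_comm]
        exact (mul_le_mul_of_nonneg_right hle (hΛpos 0 le_rfl).le).trans hN₀b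
      have h3 := hW.mul_comp_le ((one_le_inv₀ hκ0).2 h1) h2
      rw [show κ⁻¹ * (N₀ / lam) = N₀ / (κ * lam) by field_simp, inv_mul_le_iff₀ hκ0] at h3
      exact h3
  · have hev := (ENNReal.tendsto_nhds_top_iff_nnreal.1 hlim (N₀ / N₁).toNNReal).and
      (eventually_gt_atTop 0)
    obtain ⟨N, hN, hN0⟩ := hev.exists
    set κ := N₁ / (N * N₀) with hκ
    have hκ0 : 0 < κ := by positivity
    have hρκ : Real.pi * (2 * κ / Real.pi) / 2 = κ := by field_simp
    refine ⟨2 * κ / Real.pi, by positivity, core _ N₁ (by positivity) hL₁ fun lam hlam hle => ?_⟩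
    rw [hρκ]
    -- Admissible since `N₀ ≥ 1` and `λ ≤ 2 √d`.
    have hτ : 1 / (2 * Real.sqrt d) ≤ N₀ / lam := by
      rw [div_le_div_iff₀ hb hlam]
      nlinarith
    have h1 := hN.trans_le (iInf₂_le (N₀ / lam) hτ)
    have hpos := hW.num_pos _ (halfLineInv_nonneg Λ (N₀ / lam))
    have h2 : N₀ / N₁ < Θ (halfLineInv Λ (N * (N₀ / lam))) /
        (N * Θ (halfLineInv Λ (N₀ / lam))) :=
      (ENNReal.ofReal_lt_ofReal_iff_of_nonneg (by positivity)).1 h1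
    rw [div_lt_div_iff₀ hN₁ (by positivity)] at h2
    have h3 : N₁ / (κ * lam) = N * (N₀ / lam) := by
      rw [hκ]
      field_simp
    rw [h3, hκ, div_mul_eq_mul_div, le_div_iff₀ (by positivity)]
    linarith
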